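/- **Conventions.** For an irrational $\alpha\in(0,1)$ with continued fraction $[0;a_1,a_2,\dots]$ and convergent denominators $q_0=1,q_1,q_2,\dots$, let $\mathcal A_\alpha(m)$, for $m\ge 1$, be the set of integers $n\ge 0$ of the form $n=\sum_{i\ge m}c_{i+1}q_i$, where $(c_{i+1})_{i\ge 0}$ is a finitely supported sequence of integers with $c_{i+1}=0$ for $i<m$, $0\le c_1<a_1$, $0\le c_{i+1}\le a_{i+1}$ for $i\ge 1$, and $c_i=0$ whenever $c_{i+1}=a_{i+1}$, $i\ge1$ (the Ostrowski conditions). For $\gamma\in\mathbb R/\mathbb Z$ put $\mathcal J_\alpha(m,\gamma)=\gamma+\overline{\{n\alpha \bmod 1: n\in\mathcal A_\alpha(m)\}}\subseteq\mathbb R/\mathbb Z$; this is a closed interval in $\mathbb R/\mathbb Z$. Let $V$ be a $(k-1)$-dimensional subspace of $\mathbb R^k$, let $\pi:\mathbb R^k\to\mathbb R^k/\mathbb Z^k$ be the projection, and let $\ell=p+\mathbb Rw$, $w\notin V$, be a line transverse to $V$. For an index $j$ with $e_j\notin V$, write $V=\{\sum_{i\ne j}y_i(e_i+\alpha_ie_j):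 y_i\in\mathbb R\}$. A set $A\subseteq\ell$ is called a *special interval for $V$* if there are such a $j$, an index $i\neq j$ with $\alpha_i$ irrational, $m\ge 1$ and $\gamma\in\mathbb R/\mathbb Z$ such that $\{h\in\mathbb R:\ (A-he_j)\cap V\neq\emptyset\}$ (that is, $A$ moved parallel to $V$ onto the axis $\mathbb Re_j\cong\mathbb R$) is an interval with endpoints $a<b\le a+1$, each of which may or may not belong to it, and $[a,b]$ maps onto $\mathcal J_{\{\alpha_i\}}(m,\gamma)$ modulo $1$, where $\{\alpha_i\}$ is the fractional part of $\alpha_i$. For $\mathcal S\subseteq\mathbb R^k/\mathbb Z^k$ and $x\in\mathbb R^k$ let $Y_{\mathcal S,x}=\{v\in V:\pi(v+x)\in\mathcal S\}$. A separated net in $V$ is a uniformly discrete and relatively dense subset of $V$; two separated nets $Y,Y'$ in $V$ are *BD equivalent* if there is a bijection $f:Y\to Y'$ with $\sup_{y\in Y}|f(y)-y|<\infty$. A lattice in $V$ is a discrete subgroup that spans $V$ over $\mathbb R$. **Corollary 1.2.** Let $A_1,\dots,A_N\subseteq\ell$, $N\ge1$, be special intervals for $V$ whose images $\pi(A_1),\dots,\pi(A_N)$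 are pairwise disjoint, let $\mathcal S=\bigcup_{l=1}^N\pi(A_l)$, and let $x\in\mathbb R^k$. Then $Y_{\mathcal S,x}$ is a separated net in $V$ and is BD equivalent to a lattice in $V$. -/

import Mathlib

noncomputable section

namespace CutProject

/-! ### Continued fractions and Ostrowski expansions -/

/-- For irrational `α = [a₀; a₁, a₂, …]`, the partial quotient `a_{n+1}`.
(Mathlib's partial denominators are real numbers that happen to be positive integers, so the
floor only changes the type.) -/
def cfDigit (α : ℝ) (n : ℕ) : ℕ :=
  ⌊((GenContFract.of α).partDens.get? n).getD 0⌋₊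

/-- The denominator `q_n` of the `n`-th principal convergent of `α`, as a natural number. -/
def cfDen (α : ℝ) (n : ℕ) : ℕ := ⌊(GenContFract.of α).dens n⌋₊

/-- `c` is an admissible sequence of Ostrowski digits with respect to `α`. The value `c n` is the
digit usually written `c_{n+1}`, the coefficient of `q_n`. -/
structure IsOstrowskiDigits (α : ℝ) (c : ℕ →₀ ℕ) : Prop where
  zero_lt : c 0 < cfDigit α 0
  le_digit : ∀ n, c n ≤ cfDigit α n
  eq_zero_of_eq_digit : ∀ n, c (n + 1) = cfDigit α (n + 1) → c n = 0

/-- The set `𝒜(m)` of natural numbers with an Ostrowski expansion of the form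
`∑_{k ≥ m} c_{k+1} q_k`. -/
def ostrowskiTail (α : ℝ) (m : ℕ) : Set ℕ :=
  {n | ∃ c : ℕ →₀ ℕ, IsOstrowskiDigits α c ∧ (∀ i < m, c i = 0) ∧
    n = c.sum fun i d => d * cfDen α i}

/-- The special interval `𝒥(m, γ) = γ + closure {n α : n ∈ 𝒜(m)}` in `ℝ/ℤ`. -/
def specialInterval (α : ℝ) (m : ℕ) (γ : UnitAddCircle) : Set UnitAddCircle :=
  (fun y => γ + y) ''
    closure ((fun n : ℕ => (((n : ℝ) * α : ℝ) : UnitAddCircle)) '' ostrowskiTail α m)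

/-! ### Cut-and-project sets -/

variable {k : ℕ}

/-- The canonical projection `π : ℝᵏ → ℝᵏ/ℤᵏ`. -/
def torusProj (y : EuclideanSpace ℝ (Fin k)) : UnitAddTorus (Fin k) :=
  fun i => (y i : UnitAddCircle)

/-- The cut-and-project set `Y_{S,x} = {v ∈ V : π (v + x) ∈ S}`. -/
def cutAndProject (V : Submodule ℝ (EuclideanSpace ℝ (Fin k)))
    (S : Set (UnitAddTorus (Fin k))) (x : EuclideanSpace ℝ (Fin k)) : Set V :=
  {v | torusProj ((v : EuclideanSpace ℝ (Fin k)) + x) ∈ S}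

/-- The result of moving every point of `A`, in a direction parallel to `V`, to the coordinate
axis `ℝ eⱼ`, where that axis is identified with `ℝ`. -/
def slideToAxis (V : Submodule ℝ (EuclideanSpace ℝ (Fin k))) (j : Fin k)
    (A : Set (EuclideanSpace ℝ (Fin k))) : Set ℝ :=
  {h | ∃ s ∈ A, s - h • EuclideanSpace.single j (1 : ℝ) ∈ V}

/-- `A` (a subset of a line transverse to the hyperplane `V`) is a special interval for `V`.
Here `eⱼ ∉ V` is the coordinate vector written last in the parametrization
`V = {∑_{i ≠ j} yᵢ (eᵢ + αᵢ eⱼ)}`, and `α = αᵢ` is one of the irrational slopes, taken modulo one.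
The set `A`, once moved parallel to `V` to the axis `ℝ eⱼ`, has to be an interval with endpoints
`a < b ≤ a + 1` such that `[a, b]` is a lift of some `𝒥(m, γ)`. Each endpoint may belong
to `A` or not, so that open and closed windows are both covered. -/
def IsSpecialFor (V : Submodule ℝ (EuclideanSpace ℝ (Fin k)))
    (A : Set (EuclideanSpace ℝ (Fin k))) : Prop :=
  ∃ (i j : Fin k) (α : ℝ) (m : ℕ) (γ : UnitAddCircle) (a b : ℝ),
    i ≠ j ∧
    EuclideanSpace.single j (1 : ℝ) ∉ V ∧
    EuclideanSpace.single i (1 : ℝ) + α • EuclideanSpace.single j (1 : ℝ) ∈ V ∧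
    Irrational α ∧ 1 ≤ m ∧ a < b ∧ b ≤ a + 1 ∧
    (fun t : ℝ => (t : UnitAddCircle)) '' Set.Icc a b = specialInterval (Int.fract α) m γ ∧
    Set.Ioo a b ⊆ slideToAxis V j A ∧ slideToAxis V j A ⊆ Set.Icc a b

/-! ### Separated nets and bounded displacement -/

/-- Separated nets (Delone sets). -/
def IsSeparatedNet {E : Type*} [MetricSpace E] (Y : Set E) : Prop :=
  (∃ r : ℝ, 0 < r ∧ ∀ y ∈ Y, ∀ y' ∈ Y, y ≠ y' → r ≤ dist y y') ∧
  (∃ R : ℝ, 0 < R ∧ ∀ x : E, ∃ y ∈ Y, dist y x ≤ R)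

/-- Bounded displacement equivalence of separated nets. -/
structure BDEquiv {E : Type*} [MetricSpace E] (Y Y' : Set E) : Prop where
  isSeparatedNet_left : IsSeparatedNet Y
  isSeparatedNet_right : IsSeparatedNet Y'
  exists_equiv : ∃ f : Y ≃ Y', ∃ C : ℝ, ∀ y : Y, dist (f y : E) (y : E) ≤ C

/-- `Y` is BD to a lattice (a discrete subgroup of `E` that spans `E` over `ℝ`). -/
def IsBDToLattice {E : Type*} [NormedAddCommGroup E] [NormedSpace ℝ E] (Y : Set E) : Prop :=
  ∃ (L : Submodule ℤ E) (_ : DiscreteTopology L), IsZLattice ℝ L ∧ BDEquiv Y (L : Set E)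

end CutProject

end

noncomputable section

namespace CutProject

/-! ### Families of points up to bounded displacement -/

/-! Choose a functional `φ` with kernel `V` and `φ w = 1`, and call `φ n` the height of an integer
vector `n`. Up to a translation, the cut-and-project set consists of the projections along `w` of
the integer vectors whose height lies in one of finitely many windows (`mem_cutAndProject_iff`).

The arithmetic input is that the arc cut out by an Ostrowski tail has length in `ℤ + ℤ α`
(`exists_length_specialInterval`). Hence each window has length `φ u` for some integer vector `u`
(`IsSpecialFor.exists_window`). Heights in a window are bounded, so projecting along `u` instead of
`w` moves points boundedly. A half-open window of length `φ u` meets each coset of `ℤ u` exactly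
once, and projection along `u` sees only the coset. Its elements can therefore be traded for the
integer vectors with `j`-th coordinate in `[0, |u j|)`, where `u j ≠ 0`, which project to finitely
many translates of a lattice (`exists_familyBD_window`).

It remains to merge lattices. By elementary matrices, every lattice is within bounded displacement
of `ℤ^d` stretched in one coordinate (`exists_familyBD_stretch`), and Beatty sequences interleave
two such lattices into a third (`familyBD_sum_stretch`).

Indexed families are used in place of sets because intermediate projections may repeat points. For a
rational direction `w` the windows are first shrunk so that the projection along `w` is injective
(`exists_injective_window`). -/

/-- Two families of points can be matched by a bijection of their index types that moves every
point by a bounded distance. -/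
def FamilyBD {X Y E : Type*} [NormedAddCommGroup E] (F : X → E) (G : Y → E) : Prop :=
  ∃ (e : X ≃ Y) (C : ℝ), ∀ x, ‖F x - G (e x)‖ ≤ C

namespace FamilyBD

variable {X Y Z X' Y' E E' : Type*} [NormedAddCommGroup E] [NormedAddCommGroup E']
  {F : X → E} {G : Y → E} {H : Z → E}

theorem of_bounded {F G : X → E} (C : ℝ) (h : ∀ x, ‖F x - G x‖ ≤ C) : FamilyBD F G :=
  ⟨Equiv.refl X, C, h⟩

theorem refl (F : X → E) : FamilyBD F F := of_bounded 0 fun x => by simp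

theorem symm (h : FamilyBD F G) : FamilyBD G F := by
  obtain ⟨e, C, h⟩ := h
  refine ⟨e.symm, C, fun y => ?_⟩
  have := h (e.symm y)
  rwa [Equiv.apply_symm_apply, norm_sub_rev] at this

theorem trans (h : FamilyBD F G) (h' : FamilyBD G H) : FamilyBD F H := by
  obtain ⟨e, C, h⟩ := h
  obtain ⟨e', C', h'⟩ := h'
  refine ⟨e.trans e', C + C', fun x => ?_⟩
  calc ‖F x - H (e.trans e' x)‖ = ‖(F x - G (e x)) + (G (e x) - H (e' (e x)))‖ := by simp
    _ ≤ C + C' := (norm_add_le _ _).trans (add_le_add (h _) (h' _))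

theorem of_equiv (e : X ≃ Y) (h : ∀ x, F x = G (e x)) : FamilyBD F G :=
  ⟨e, 0, fun x => by simp [h]⟩

theorem map [NormedSpace ℝ E] [NormedSpace ℝ E'] (A : E →L[ℝ] E') (h : FamilyBD F G) :
    FamilyBD (fun x => A (F x)) (fun y => A (G y)) := by
  obtain ⟨e, C, h⟩ := h
  refine ⟨e, ‖A‖ * C, fun x => ?_⟩
  rw [← map_sub]
  exact (A.le_opNorm _).trans (mul_le_mul_of_nonneg_left (h x) (norm_nonneg _))

theorem sum {F' : X' → E} {G' : Y' → E} (h : FamilyBD F G) (h' : FamilyBD F' G') :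
    FamilyBD (Sum.elim F F') (Sum.elim G G') := by
  obtain ⟨e, C, h⟩ := h
  obtain ⟨e', C', h'⟩ := h'
  refine ⟨Equiv.sumCongr e e', max C C', ?_⟩
  rintro (x | x)
  · simpa using Or.inl (h x)
  · simpa using Or.inr (h' x)

end FamilyBD

/-! ### Lattices up to bounded displacement -/

section Lattice

open Matrix

variable {ι : Type*} [Fintype ι] [DecidableEq ι]

/-- The points of the lattice `M ℤ^ι`, indexed by `ℤ^ι`. -/
def latticePoint (M : Matrix ι ι ℝ) (n : ι → ℤ) : ι → ℝ := M *ᵥ fun i => (n i : ℝ)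

theorem familyBD_latticePoint_mul_left {ι : Type*} [Fintype ι] (A : Matrix ι ι ℝ)
    {M M' : Matrix ι ι ℝ}
    (h : FamilyBD (latticePoint M) (latticePoint M')) :
    FamilyBD (latticePoint (A * M)) (latticePoint (A * M')) := by
  have := h.map (Matrix.mulVecLin A).toContinuousLinearMap
  simp only [latticePoint, LinearMap.coe_toContinuousLinearMap', Matrix.mulVecLin_apply,
    Matrix.mulVec_mulVec] at this
  exact this

/-- A shear is matched with the identity by rounding the added multiple down. The rounded shear is
still a bijection of the integer vectors because coordinate `j` is untouched. -/
theorem familyBD_transvection {i j : ι} (hij : i ≠ j) (t : ℝ) :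
    FamilyBD (latticePoint (Matrix.transvection i j t)) (latticePoint (1 : Matrix ι ι ℝ)) := by
  refine ⟨⟨fun n => Function.update n i (n i + ⌊t * n j⌋),
    fun n => Function.update n i (n i - ⌊t * n j⌋), fun n => ?_, fun n => ?_⟩, 1, fun n => ?_⟩
  · ext l
    by_cases h : l = i
    · subst h; simp [Function.update_of_ne hij.symm]
    · simp [h]
  · ext l
    by_cases h : l = i
    · subst h; simp [Function.update_of_ne hij.symm]
    · simp [h]
  · rw [pi_norm_le_iff_of_nonneg zero_le_one]
    intro l
    simp only [latticePoint, Matrix.transvection, Matrix.add_mulVec, Matrix.one_mulVec,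
      Equiv.coe_fn_mk, Pi.sub_apply, Pi.add_apply, Matrix.single_mulVec]
    by_cases h : l = i
    · subst h
      simp only [Function.update_self, Int.cast_add, Real.norm_eq_abs]
      rw [abs_le]
      constructor <;> linarith [Int.floor_le (t * n j), Int.lt_floor_add_one (t * n j)]
    · simp [h]

theorem transvection_mul_diagonal {i j : ι} (t : ℝ) (D : ι → ℝ) (hD : ∀ i, D i ≠ 0) :
    Matrix.transvection i j t * Matrix.diagonal D =
      Matrix.diagonal D * Matrix.transvection i j ((D i)⁻¹ * t * D j) := by
  ext a b
  simp only [Matrix.mul_diagonal, Matrix.diagonal_mul, Matrix.transvection, Matrix.add_apply,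
    Matrix.one_apply, Matrix.single_apply]
  have := hD i
  split_ifs with h1 h2 h2 <;> grind

theorem familyBD_mul_transvection (M : Matrix ι ι ℝ) {i j : ι} (hij : i ≠ j) (t : ℝ) :
    FamilyBD (latticePoint (M * Matrix.transvection i j t)) (latticePoint M) := by
  simpa using familyBD_latticePoint_mul_left M (familyBD_transvection hij t)

/-- The diagonal matrix with one entry `c` at `o` and all others `1`. -/
def stretch (o : ι) (c : ℝ) : Matrix ι ι ℝ := Matrix.diagonal (Function.update 1 o c)

/-- The four transvections multiply to the diagonal matrix with `D i` at `i` and its inverse at `o`.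
Thus the scaling of coordinate `i` can be transferred to `o` at bounded cost. -/
theorem diagonal_eq_transvections {i o : ι} (hio : i ≠ o) (D : ι → ℝ) (hD : D i ≠ 0) :
    Matrix.diagonal D = Matrix.diagonal (Function.update (Function.update D i 1) o (D o * D i)) *
      Matrix.transvection o i ((D i)⁻¹ - 1) * Matrix.transvection i o 1 *
      Matrix.transvection o i (D i - 1) * Matrix.transvection i o (-(D i)⁻¹) := by
  ext a b
  by_cases hbo : b = o
  · subst hbo
    simp only [Matrix.mul_transvection_apply_same, Matrix.mul_transvection_apply_of_ne _ _ _ _ hio,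
      Matrix.mul_transvection_apply_of_ne _ _ _ _ hio.symm, Matrix.diagonal_apply,
      Function.update_apply]
    split_ifs <;> grind
  · by_cases hbi : b = i
    · subst hbi
      simp only [Matrix.mul_transvection_apply_same, Matrix.mul_transvection_apply_of_ne _ _ _ _ hio,
        Matrix.mul_transvection_apply_of_ne _ _ _ _ hio.symm, Matrix.diagonal_apply,
        Function.update_apply]
      split_ifs <;> grind
    · simp only [Matrix.mul_transvection_apply_of_ne _ _ _ _ hbo,
        Matrix.mul_transvection_apply_of_ne _ _ _ _ hbi, Matrix.diagonal_apply,
        Function.update_apply]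
      split_ifs <;> grind

theorem familyBD_diagonal_update {i o : ι} (hio : i ≠ o) (D : ι → ℝ) (hD : D i ≠ 0) :
    FamilyBD (latticePoint (Matrix.diagonal D)) (latticePoint
      (Matrix.diagonal (Function.update (Function.update D i 1) o (D o * D i)))) := by
  rw [diagonal_eq_transvections hio D hD]
  exact (familyBD_mul_transvection _ hio _).trans ((familyBD_mul_transvection _ hio.symm _).trans
    ((familyBD_mul_transvection _ hio _).trans (familyBD_mul_transvection _ hio.symm _)))

theorem familyBD_diagonal (o : ι) (D : ι → ℝ) (hD : ∀ i, D i ≠ 0) :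
    ∃ c ≠ 0, FamilyBD (latticePoint (Matrix.diagonal D)) (latticePoint (stretch o c)) := by
  suffices h : ∀ s : Finset ι, ∀ D : ι → ℝ, (∀ i, D i ≠ 0) → (∀ i ∉ s, i ≠ o → D i = 1) →
      ∃ c ≠ 0, FamilyBD (latticePoint (Matrix.diagonal D)) (latticePoint (stretch o c)) from
    h Finset.univ D hD (by simp)
  intro s
  induction s using Finset.induction_on with
  | empty =>
    intro D hD h
    refine ⟨D o, hD o, ?_⟩
    have : D = Function.update (1 : ι → ℝ) o (D o) := by
      ext i
      by_cases hi : i = o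
      · subst hi; simp
      · simp [hi, h i]
    rw [stretch, ← this]
    exact .refl _
  | insert a s ha ih =>
    intro D hD h
    by_cases hao : a = o
    · exact ih D hD fun i hi hio => h i (by grind) hio
    · obtain ⟨c, hc, h'⟩ := ih (Function.update (Function.update D a 1) o (D o * D a))
        (fun i => by simp only [Function.update_apply]; split_ifs <;> simp [hD])
        (fun i hi hio => by
          simp only [Function.update_apply, if_neg hio]
          split_ifs with h1
          · rfl
          · exact h i (by simp [hi, h1]) hio)
      exact ⟨c, hc, (familyBD_diagonal_update hao D (hD a)).trans h'⟩

theorem familyBD_stretch_neg (o : ι) (c : ℝ) :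
    FamilyBD (latticePoint (stretch o c)) (latticePoint (stretch o (-c))) := by
  refine .of_equiv (Equiv.piCongrRight fun i => if i = o then Equiv.neg ℤ else Equiv.refl ℤ) ?_
  intro n
  ext i
  simp only [latticePoint, stretch, Matrix.mulVec_diagonal, Function.update_apply]
  by_cases h : i = o <;> simp [h]

theorem exists_familyBD_stretch (o : ι) (M : Matrix ι ι ℝ) (hM : M.det ≠ 0) :
    ∃ c > 0, FamilyBD (latticePoint M) (latticePoint (stretch o c)) := by
  -- The extra right factor makes the claim stable under products: in `A * B * stretch o c` first
  -- `B`, then `A`, is absorbed into the stretch.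
  suffices h : ∀ c ≠ 0, ∃ c' ≠ 0,
      FamilyBD (latticePoint (M * stretch o c)) (latticePoint (stretch o c')) by
    obtain ⟨c, hc, h⟩ := h 1 one_ne_zero
    have h1 : stretch o (1 : ℝ) = 1 := by simp [stretch]
    rw [h1, mul_one] at h
    rcases lt_or_gt_of_ne hc with hc | hc
    · exact ⟨-c, by linarith, h.trans (familyBD_stretch_neg o c)⟩
    · exact ⟨c, hc, h⟩
  have hs : ∀ c : ℝ, c ≠ 0 → ∀ i, Function.update (1 : ι → ℝ) o c i ≠ 0 := by
    intro c hc i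
    simp only [Function.update_apply]
    split_ifs <;> simp [hc]
  refine Matrix.diagonal_transvection_induction_of_det_ne_zero
    (fun M => ∀ c ≠ 0, ∃ c' ≠ 0,
      FamilyBD (latticePoint (M * stretch o c)) (latticePoint (stretch o c'))) M hM ?_ ?_ ?_
  · intro D hD c hc
    rw [stretch, Matrix.diagonal_mul_diagonal]
    refine familyBD_diagonal o _ fun i => mul_ne_zero ?_ (hs c hc i)
    rw [Matrix.det_diagonal] at hD
    exact Finset.prod_ne_zero_iff.1 hD i (Finset.mem_univ i)
  · intro t c hc
    refine ⟨c, hc, ?_⟩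
    rw [stretch, TransvectionStruct.toMatrix, transvection_mul_diagonal _ _ (hs c hc)]
    exact familyBD_mul_transvection _ t.hij _
  · intro A B _ _ hA hB c hc
    obtain ⟨c', hc', h'⟩ := hB c hc
    obtain ⟨c'', hc'', h''⟩ := hA c' hc'
    refine ⟨c'', hc'', ?_⟩
    rw [mul_assoc]
    exact (familyBD_latticePoint_mul_left A h').trans h''

/-! ### Unions of lattices -/

/-- Two complementary Beatty-type sequences partition the integers. -/
theorem exists_beatty_equiv {β : ℝ} (h0 : 0 < β) (h1 : β < 1) :
    ∃ e : ℤ ⊕ ℤ ≃ ℤ, (∀ n : ℤ, |(n : ℝ) - β * e (.inl n)| ≤ 1) ∧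
      ∀ n : ℤ, |(n : ℝ) - (1 - β) * e (.inr n)| ≤ 1 := by
  let f : ℤ → ℤ := fun m => ⌊m * β⌋
  have hf1 : ∀ m, f m ≤ f (m + 1) := fun m => Int.floor_le_floor (by push_cast; nlinarith)
  have hf2 : ∀ m, f (m + 1) ≤ f m + 1 := fun m => by
    rw [← Int.floor_add_one]
    exact Int.floor_le_floor (by push_cast; nlinarith)
  have hf : Monotone f := monotone_int_of_le_succ hf1
  have hg : Monotone fun m => m - f m := monotone_int_of_le_succ fun m => by linarith [hf2 m]
  -- The integers at which `⌊mβ⌋` is about to jump have density `β` and are numbered by `f m`; the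
  -- others have density `1 - β` and are numbered by `m - f m`.
  let g : ℤ → ℤ ⊕ ℤ := fun m => if f (m + 1) = f m + 1 then .inl (f m) else .inr (m - f m)
  have hbij : Function.Bijective g := by
    constructor
    · refine Function.Injective.of_lt_imp_ne fun m m' hm h => ?_
      have h1 := hf (Int.add_one_le_of_lt hm)
      have h2 := hg (Int.add_one_le_of_lt hm)
      have h3 := hf1 m
      have h4 := hf2 m
      simp only [g] at h h2
      split_ifs at h
      · simp only [Sum.inl.injEq] at h
        omega
      · simp only [Sum.inr.injEq] at h
        omega
    · rintro (n | n)
      -- The last `m` with `mβ < n + 1`: the jump from `n` to `n + 1` happens right after it.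
      · refine ⟨⌈(n + 1) / β⌉ - 1, ?_⟩
        set m := ⌈(n + 1) / β⌉ - 1 with hm
        have e1 : ((m : ℝ)) < (n + 1) / β := by
          have := Int.ceil_lt_add_one ((n + 1) / β)
          rw [hm]; push_cast; linarith
        have e2 : (n + 1) / β ≤ ((m : ℝ)) + 1 := by
          have := Int.le_ceil ((n + 1) / β)
          rw [hm]; push_cast; linarith
        rw [lt_div_iff₀ h0] at e1
        rw [div_le_iff₀ h0] at e2
        have e3 : f m < n + 1 := by rw [Int.floor_lt]; exact_mod_cast e1
        have e4 : n + 1 ≤ f (m + 1) := by rw [Int.le_floor]; exact_mod_cast e2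
        have := hf2 m
        have e5 : f m = n := by omega
        have e6 : f (m + 1) = f m + 1 := by omega
        simp [g, e6, e5]
      -- The last `m` with `m(1 - β) ≤ n`: there `m - f m` equals `n` and is about to increase, so
      -- `f` does not jump.
      · refine ⟨⌊n / (1 - β)⌋, ?_⟩
        set m := ⌊n / (1 - β)⌋ with hm
        have h2 : 0 < 1 - β := by linarith
        have e1 := Int.floor_le (n / (1 - β))
        have e2 := Int.lt_floor_add_one (n / (1 - β))
        rw [← hm, le_div_iff₀ h2] at e1
        rw [← hm, div_lt_iff₀ h2] at e2
        have e3 : m - n ≤ f m := by rw [Int.le_floor]; push_cast; linarith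
        have e4 : f (m + 1) < m + 1 - n := by rw [Int.floor_lt]; push_cast; linarith
        have := hf1 m
        have e5 : m - f m = n := by omega
        have e6 : ¬ f (m + 1) = f m + 1 := by omega
        simp [g, e6, e5]
  have hcancel : ∀ s, g ((Equiv.ofBijective g hbij).symm s) = s := fun s =>
    Equiv.ofBijective_apply_symm_apply g hbij s
  refine ⟨(Equiv.ofBijective g hbij).symm, fun n => ?_, fun n => ?_⟩
  · have h := hcancel (.inl n)
    generalize (Equiv.ofBijective g hbij).symm (.inl n) = m at h
    simp only [g] at h
    split_ifs at h
    simp only [Sum.inl.injEq] at h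
    rw [← h, abs_le]
    constructor <;> linarith [Int.floor_le (m * β), Int.lt_floor_add_one (m * β)]
  · have h := hcancel (.inr n)
    generalize (Equiv.ofBijective g hbij).symm (.inr n) = m at h
    simp only [g] at h
    split_ifs at h
    simp only [Sum.inr.injEq] at h
    rw [← h, abs_le]
    push_cast
    constructor <;> linarith [Int.floor_le (m * β), Int.lt_floor_add_one (m * β)]

/-- On each line parallel to axis `o` the densities add: `1/c = 1/c₁ + 1/c₂`. With `β = c₂/(c₁ +
c₂)` one has `c = c₁ β = c₂ (1 - β)`, so the Beatty partition of the `o`-coordinate matches the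
points. -/
theorem familyBD_sum_stretch (o : ι) {c₁ c₂ : ℝ} (h₁ : 0 < c₁) (h₂ : 0 < c₂) :
    ∃ c > 0, FamilyBD (Sum.elim (latticePoint (stretch o c₁)) (latticePoint (stretch o c₂)))
      (latticePoint (stretch o c)) := by
  obtain ⟨e, he₁, he₂⟩ := exists_beatty_equiv (β := c₂ / (c₁ + c₂)) (by positivity)
    (by rw [div_lt_one (by positivity)]; linarith)
  refine ⟨c₁ * c₂ / (c₁ + c₂), by positivity, ?_⟩
  let f : (ι → ℤ) ⊕ (ι → ℤ) → (ι → ℤ) :=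
    Sum.elim (fun n => Function.update n o (e (.inl (n o))))
      (fun n => Function.update n o (e (.inr (n o))))
  have hf : Function.Bijective f := by
    constructor
    · have key : ∀ (n n' : ι → ℤ) a b, Function.update n o a = Function.update n' o b →
          a = b ∧ ∀ i ≠ o, n i = n' i := by
        intro n n' a b h
        refine ⟨by simpa using congrFun h o, fun i hi => by simpa [hi] using congrFun h i⟩
      rintro (n | n) (n' | n') h
      all_goals
        obtain ⟨h1, h2⟩ := key _ _ _ _ h
        have h3 := e.injective h1
        simp at h3
      all_goals
        congr 1
        ext i
        by_cases hi : i = o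
        · rw [hi, h3]
        · exact h2 i hi
    · intro m
      rcases h : e.symm (m o) with a | a
      · refine ⟨.inl (Function.update m o a), ?_⟩
        have : e (.inl a) = m o := by rw [← h, Equiv.apply_symm_apply]
        simp [f, this]
      · refine ⟨.inr (Function.update m o a), ?_⟩
        have : e (.inr a) = m o := by rw [← h, Equiv.apply_symm_apply]
        simp [f, this]
  refine ⟨Equiv.ofBijective f hf, max c₁ c₂, ?_⟩
  rintro (n | n)
  all_goals
    rw [pi_norm_le_iff_of_nonneg (by positivity)]
    intro i
    simp only [Sum.elim_inl, Sum.elim_inr, Equiv.ofBijective_apply, f, latticePoint, stretch,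
      Matrix.mulVec_diagonal, Pi.sub_apply, Real.norm_eq_abs]
    by_cases hi : i = o
    swap
    · simp [hi, h₁.le]
    subst hi
    simp only [Function.update_self]
  · refine le_trans ?_ (le_max_left _ _)
    have := he₁ (n i)
    rw [show c₁ * (n i : ℝ) - c₁ * c₂ / (c₁ + c₂) * (e (.inl (n i)) : ℝ) =
      c₁ * ((n i : ℝ) - c₂ / (c₁ + c₂) * e (.inl (n i))) by ring, abs_mul, abs_of_pos h₁]
    nlinarith
  · refine le_trans ?_ (le_max_right _ _)
    have := he₂ (n i)
    rw [show c₂ * (n i : ℝ) - c₁ * c₂ / (c₁ + c₂) * (e (.inr (n i)) : ℝ) =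
      c₂ * ((n i : ℝ) - (1 - c₂ / (c₁ + c₂)) * e (.inr (n i))) by field_simp; ring, abs_mul,
      abs_of_pos h₂]
    nlinarith

/-- A nonempty finite disjoint union of families that are close to multiples of the standard
lattice is of the same kind. -/
theorem familyBD_sigma_stretch (o : ι) {N : ℕ} (hN : 0 < N) {X : Fin N → Type*}
    (F : ∀ l, X l → ι → ℝ)
    (h : ∀ l, ∃ c > 0, FamilyBD (F l) (latticePoint (stretch o c))) :
    ∃ c > 0, FamilyBD (fun x : Σ l, X l => F x.1 x.2) (latticePoint (stretch o c)) := by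
  induction N, hN using Nat.le_induction with
  | base =>
    obtain ⟨c, hc, h⟩ := h 0
    refine ⟨c, hc, .trans (.of_equiv (Equiv.uniqueSigma X) ?_) h⟩
    rintro ⟨l, x⟩
    obtain rfl : l = default := Subsingleton.elim _ _
    rfl
  | succ N hN ih =>
    obtain ⟨c₁, hc₁, h₁⟩ := ih (fun l => F l.castSucc) (fun l => h _)
    obtain ⟨c₂, hc₂, h₂⟩ := h (Fin.last N)
    obtain ⟨c, hc, h'⟩ := familyBD_sum_stretch o hc₁ hc₂
    refine ⟨c, hc, .trans (.symm (.of_equiv (Equiv.ofBijective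
      (Sum.elim (fun x => ⟨x.1.castSucc, x.2⟩) (fun x => ⟨Fin.last N, x⟩)) ⟨?_, ?_⟩) ?_))
      ((h₁.sum h₂).trans h')⟩
    · rintro (⟨l, x⟩ | x) (⟨l', x'⟩ | x') h
      · simp only [Sum.elim_inl, Sigma.mk.injEq, Fin.castSucc_inj] at h
        obtain ⟨rfl, h⟩ := h
        simp_all
      · simp only [Sum.elim_inl, Sum.elim_inr, Sigma.mk.injEq] at h
        exact absurd h.1 (Fin.castSucc_lt_last l).ne
      · simp only [Sum.elim_inl, Sum.elim_inr, Sigma.mk.injEq] at h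
        exact absurd h.1 (Fin.castSucc_lt_last l').ne'
      · simp_all
    · rintro ⟨l, x⟩
      induction l using Fin.lastCases with
      | last => exact ⟨.inr x, rfl⟩
      | cast l => exact ⟨.inl ⟨l, x⟩, rfl⟩
    · rintro (⟨l, x⟩ | x) <;> rfl

end Lattice

open Filter Topology

/-! ### Continued fraction expansions of irrational numbers -/

/-- The orbit of the fractional part of `v` under the Gauss map `x ↦ fract x⁻¹`. -/
def gaussOrbit (v : ℝ) : ℕ → ℝ
  | 0 => Int.fract v
  | n + 1 => Int.fract (gaussOrbit v n)⁻¹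

theorem irrational_fract {v : ℝ} (hv : Irrational v) : Irrational (Int.fract v) := by
  rw [← Int.self_sub_floor]
  exact hv.sub_intCast _

theorem irrational_gaussOrbit {v : ℝ} (hv : Irrational v) (n : ℕ) :
    Irrational (gaussOrbit v n) := by
  induction n with
  | zero => exact irrational_fract hv
  | succ n ih => exact irrational_fract ih.inv

theorem gaussOrbit_lt_one (v : ℝ) (n : ℕ) : gaussOrbit v n < 1 := by
  cases n <;> exact Int.fract_lt_one _

theorem gaussOrbit_pos {v : ℝ} (hv : Irrational v) (n : ℕ) : 0 < gaussOrbit v n := by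
  refine lt_of_le_of_ne ?_ (irrational_gaussOrbit hv n).ne_zero.symm
  cases n <;> exact Int.fract_nonneg _

theorem gaussOrbit_inv_fract (v : ℝ) (n : ℕ) :
    gaussOrbit (Int.fract v)⁻¹ n = gaussOrbit v (n + 1) := by
  induction n with
  | zero => rfl
  | succ n ih => rw [gaussOrbit, ih]; rfl

theorem get?_genContFract {v : ℝ} (hv : Irrational v) (n : ℕ) :
    (GenContFract.of v).s.get? n = some ⟨1, (⌊(gaussOrbit v n)⁻¹⌋ : ℝ)⟩ := by
  induction n generalizing v with
  | zero => exact GenContFract.of_s_head (irrational_fract hv).ne_zero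
  | succ n ih =>
    rw [GenContFract.of_s_succ, ih (irrational_fract hv).inv, gaussOrbit_inv_fract]

theorem natCast_cfDigit {v : ℝ} (hv : Irrational v) (n : ℕ) :
    (cfDigit v n : ℝ) = ⌊(gaussOrbit v n)⁻¹⌋ := by
  have h : (GenContFract.of v).partDens.get? n = some (⌊(gaussOrbit v n)⁻¹⌋ : ℝ) :=
    GenContFract.partDen_eq_s_b (get?_genContFract hv n)
  have h0 : 0 ≤ ⌊(gaussOrbit v n)⁻¹⌋ := Int.floor_nonneg.2 (inv_pos.2 (gaussOrbit_pos hv n)).le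
  obtain ⟨N, hN⟩ := Int.eq_ofNat_of_zero_le h0
  simp [cfDigit, h, hN]

theorem get?_genContFract_eq_cfDigit {v : ℝ} (hv : Irrational v) (n : ℕ) :
    (GenContFract.of v).s.get? n = some ⟨1, cfDigit v n⟩ := by
  rw [get?_genContFract hv, natCast_cfDigit hv]

theorem one_le_cfDigit {v : ℝ} (hv : Irrational v) (n : ℕ) : 1 ≤ cfDigit v n := by
  have h := natCast_cfDigit hv n
  have h1 : 1 ≤ ⌊(gaussOrbit v n)⁻¹⌋ := by
    rw [Int.le_floor]
    exact_mod_cast (one_le_inv₀ (gaussOrbit_pos hv n)).2 (gaussOrbit_lt_one v n).le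
  have h2 : ((cfDigit v n : ℤ) : ℝ) = (⌊(gaussOrbit v n)⁻¹⌋ : ℝ) := by exact_mod_cast h
  have h3 := Int.cast_injective h2
  omega

theorem natCast_cfDen {v : ℝ} (hv : Irrational v) (n : ℕ) :
    (cfDen v n : ℝ) = (GenContFract.of v).dens n := by
  suffices h : ∃ N : ℕ, (GenContFract.of v).dens n = N by
    obtain ⟨N, hN⟩ := h
    simp [cfDen, hN]
  induction n using Nat.twoStepInduction with
  | zero => exact ⟨1, by simp [GenContFract.zeroth_den_eq_one]⟩
  | one => exact ⟨_, GenContFract.first_den_eq (get?_genContFract_eq_cfDigit hv 0)⟩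
  | more n ih₁ ih₂ =>
    obtain ⟨N₁, h₁⟩ := ih₁
    obtain ⟨N₂, h₂⟩ := ih₂
    refine ⟨cfDigit v (n + 1) * N₂ + N₁, ?_⟩
    rw [GenContFract.dens_recurrence (get?_genContFract_eq_cfDigit hv (n + 1)) h₁ h₂]
    push_cast
    ring

theorem cfDen_zero (v : ℝ) : cfDen v 0 = 1 := by
  simp [cfDen, GenContFract.zeroth_den_eq_one]

theorem cfDen_one {v : ℝ} (hv : Irrational v) : cfDen v 1 = cfDigit v 0 := by
  have := GenContFract.first_den_eq (get?_genContFract_eq_cfDigit hv 0)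
  rw [← natCast_cfDen hv] at this
  exact Nat.cast_injective this

theorem cfDen_add_two {v : ℝ} (hv : Irrational v) (n : ℕ) :
    cfDen v (n + 2) = cfDigit v (n + 1) * cfDen v (n + 1) + cfDen v n := by
  have := GenContFract.dens_recurrence (get?_genContFract_eq_cfDigit hv (n + 1)) rfl rfl
  simp only [← natCast_cfDen hv, one_mul] at this
  exact_mod_cast this

theorem cfDen_pos {v : ℝ} (hv : Irrational v) (n : ℕ) : 0 < cfDen v n := by
  induction n using Nat.twoStepInduction with
  | zero => simp [cfDen_zero]
  | one => rw [cfDen_one hv]; exact one_le_cfDigit hv 0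
  | more n ih₁ ih₂ => rw [cfDen_add_two hv]; omega

/-- The distance `|q_n v - p_n|`, as a product along the orbit of the Gauss map. -/
def cfRemainder (v : ℝ) (n : ℕ) : ℝ := ∏ i ∈ Finset.range (n + 1), gaussOrbit v i

theorem cfRemainder_pos {v : ℝ} (hv : Irrational v) (n : ℕ) : 0 < cfRemainder v n :=
  Finset.prod_pos fun i _ => gaussOrbit_pos hv i

theorem cfRemainder_zero (v : ℝ) : cfRemainder v 0 = Int.fract v := by
  simp [cfRemainder, gaussOrbit]

theorem cfDigit_mul_gaussOrbit {v : ℝ} (hv : Irrational v) (n : ℕ) :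
    cfDigit v n * gaussOrbit v n + gaussOrbit v n * gaussOrbit v (n + 1) = 1 := by
  rw [natCast_cfDigit hv, gaussOrbit, ← Int.self_sub_floor]
  field_simp [(gaussOrbit_pos hv n).ne']
  ring

theorem cfDigit_mul_cfRemainder_zero {v : ℝ} (hv : Irrational v) :
    cfDigit v 0 * cfRemainder v 0 + cfRemainder v 1 = 1 := by
  simpa [cfRemainder, Finset.prod_range_succ] using cfDigit_mul_gaussOrbit hv 0

/-- With `βₙ` for `cfRemainder v n`, this is the recurrence behind the telescoping sums and the
error bounds for Ostrowski expansions below. -/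
theorem cfDigit_mul_cfRemainder {v : ℝ} (hv : Irrational v) (n : ℕ) :
    cfDigit v (n + 1) * cfRemainder v (n + 1) + cfRemainder v (n + 2) = cfRemainder v n := by
  have h := cfDigit_mul_gaussOrbit hv (n + 1)
  simp only [cfRemainder, Finset.prod_range_succ _ (n + 2), Finset.prod_range_succ _ (n + 1)]
  linear_combination (∏ i ∈ Finset.range (n + 1), gaussOrbit v i) * h

theorem antitone_cfRemainder {v : ℝ} (hv : Irrational v) : Antitone (cfRemainder v) := by
  refine antitone_nat_of_succ_le fun n => ?_
  rw [cfRemainder, Finset.prod_range_succ]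
  exact mul_le_of_le_one_right (cfRemainder_pos hv n).le (gaussOrbit_lt_one v _).le

theorem cfRemainder_add_succ_le {v : ℝ} (hv : Irrational v) (n : ℕ) :
    cfRemainder v (n + 1) + cfRemainder v (n + 2) ≤ cfRemainder v n := by
  have h : (1 : ℝ) ≤ cfDigit v (n + 1) := by exact_mod_cast one_le_cfDigit hv (n + 1)
  nlinarith [cfDigit_mul_cfRemainder hv n, cfRemainder_pos hv (n + 1)]

/-- The decreasing sequence has a limit `L ≥ 0`, and `βₙ₊₁ + βₙ₊₂ ≤ βₙ` gives `2L ≤ L`. -/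
theorem tendsto_cfRemainder {v : ℝ} (hv : Irrational v) :
    Tendsto (cfRemainder v) atTop (𝓝 0) := by
  have h := tendsto_atTop_ciInf (antitone_cfRemainder hv)
    ⟨0, by rintro _ ⟨n, rfl⟩; exact (cfRemainder_pos hv n).le⟩
  set L := ⨅ n, cfRemainder v n
  have h0 : 0 ≤ L := le_ciInf fun n => (cfRemainder_pos hv n).le
  have h1 : L + L ≤ L := le_of_tendsto_of_tendsto'
    (((tendsto_add_atTop_iff_nat 1).2 h).add ((tendsto_add_atTop_iff_nat 2).2 h)) h
    (cfRemainder_add_succ_le hv)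
  rwa [show L = 0 by linarith] at h

theorem exists_cfDen_mul_sub {v : ℝ} (hv : Irrational v) (n : ℕ) :
    ∃ p : ℤ, cfDen v n * Int.fract v - p = (-1) ^ n * cfRemainder v n := by
  induction n using Nat.twoStepInduction with
  | zero => exact ⟨0, by simp [cfDen_zero, cfRemainder_zero]⟩
  | one =>
    refine ⟨1, ?_⟩
    have := cfDigit_mul_cfRemainder_zero hv
    rw [cfRemainder_zero] at this
    rw [cfDen_one hv]
    push_cast
    linarith
  | more n ih₁ ih₂ =>
    obtain ⟨p₁, h₁⟩ := ih₁
    obtain ⟨p₂, h₂⟩ := ih₂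
    refine ⟨cfDigit v (n + 1) * p₂ + p₁, ?_⟩
    rw [cfDen_add_two hv]
    push_cast
    have := cfDigit_mul_cfRemainder hv n
    rw [pow_succ] at h₂
    rw [pow_add]
    linear_combination (cfDigit v (n + 1) : ℝ) * h₂ + h₁ - (-1) ^ n * this

/-! ### Ostrowski sums -/

/-- Peeling off the leading digit leaves minus a sum of the same shape, starting one place later.
The bounds close up because `c (j+1) * β_{j+1} ≤ β_j - β_{j+2}`. -/
theorem ostrowski_sum_mem_Icc {v : ℝ} (hv : Irrational v) {c : ℕ → ℕ}
    (hc : ∀ n, c n ≤ cfDigit v n) (L j : ℕ) :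
    ∑ i ∈ Finset.range L, (c (j + 1 + i) : ℝ) * ((-1) ^ i * cfRemainder v (j + 1 + i)) ∈
      Set.Icc (-cfRemainder v (j + 1)) (cfRemainder v j) := by
  induction L generalizing j with
  | zero => simp [(cfRemainder_pos hv _).le]
  | succ L ih =>
    have h := ih (j + 1)
    rw [Finset.sum_range_succ']
    have e : ∀ i ∈ Finset.range L, (c (j + 1 + (i + 1)) : ℝ) *
        ((-1) ^ (i + 1) * cfRemainder v (j + 1 + (i + 1))) =
        -((c (j + 1 + 1 + i) : ℝ) * ((-1) ^ i * cfRemainder v (j + 1 + 1 + i))) := by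
      intro i _
      rw [show j + 1 + (i + 1) = j + 1 + 1 + i by ring]
      ring
    rw [Finset.sum_congr rfl e, Finset.sum_neg_distrib]
    have h1 : (c (j + 1) : ℝ) ≤ cfDigit v (j + 1) := by exact_mod_cast hc (j + 1)
    have h2 := cfDigit_mul_cfRemainder hv j
    have h3 := cfRemainder_pos hv (j + 1)
    have h4 : (0 : ℝ) ≤ c (j + 1) := by positivity
    simp only [Set.mem_Icc] at h ⊢
    simp only [add_zero, pow_zero, one_mul]
    constructor <;> nlinarith

theorem unitAddCircle_coe_eq_iff {s t : ℝ} :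
    (s : UnitAddCircle) = t ↔ ∃ n : ℤ, s = t + n := by
  rw [← sub_eq_zero, ← AddCircle.coe_sub, AddCircle.coe_eq_zero_iff]
  simp only [zsmul_eq_mul, mul_one]
  exact exists_congr fun n => ⟨fun h => by linarith, fun h => by linarith⟩

theorem unitAddCircle_coe_sum {v : ℝ} (hv : Irrational v) (s : Finset ℕ) (c : ℕ → ℕ) :
    (((∑ i ∈ s, c i * cfDen v i : ℕ) * Int.fract v : ℝ) : UnitAddCircle) =
      (∑ i ∈ s, c i * ((-1) ^ i * cfRemainder v i) : ℝ) := by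
  choose p hp using exists_cfDen_mul_sub hv
  refine unitAddCircle_coe_eq_iff.2 ⟨∑ i ∈ s, c i * p i, ?_⟩
  push_cast
  rw [Finset.sum_mul, ← Finset.sum_add_distrib]
  refine Finset.sum_congr rfl fun i _ => ?_
  rw [← hp]
  ring

/-! ### Lengths of special intervals -/

theorem image_ostrowskiTail_subset {v : ℝ} (hv : Irrational v) (m : ℕ) {n : ℕ}
    (hn : n ∈ ostrowskiTail v (m + 1)) :
    ∃ t ∈ Set.Icc (-cfRemainder v (m + 1)) (cfRemainder v m),
      ((n * Int.fract v : ℝ) : UnitAddCircle) = ((-1) ^ (m + 1) * t : ℝ) := by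
  obtain ⟨c, hc, h0, rfl⟩ := hn
  obtain ⟨L, hL⟩ : ∃ L, c.support ⊆ Finset.range (m + 1 + L) := by
    obtain ⟨L, hL⟩ := c.support.exists_nat_subset_range
    exact ⟨L, hL.trans (Finset.range_subset_range.2 (by omega))⟩
  refine ⟨_, ostrowski_sum_mem_Icc hv hc.le_digit L m, ?_⟩
  rw [Finsupp.sum_of_support_subset _ hL _ (by simp), unitAddCircle_coe_sum hv,
    Finset.sum_range_add, Finset.sum_eq_zero, zero_add, Finset.mul_sum]
  · congr 1
    refine Finset.sum_congr rfl fun i _ => ?_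
    rw [pow_add]
    ring
  · intro i hi
    rw [h0 i (Finset.mem_range.1 hi)]
    simp

/-- The digit sequence that is maximal at `L` places of the same parity, starting from `s + 1`. -/
def alternatingDigits (v : ℝ) (s L : ℕ) : ℕ →₀ ℕ :=
  ∑ t ∈ Finset.range L, Finsupp.single (s + 1 + 2 * t) (cfDigit v (s + 1 + 2 * t))

theorem alternatingDigits_apply (v : ℝ) (s L n : ℕ) : alternatingDigits v s L n =
    if ∃ t < L, n = s + 1 + 2 * t then cfDigit v n else 0 := by
  simp only [alternatingDigits, Finsupp.coe_finsetSum, Finset.sum_apply]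
  split_ifs with h
  · obtain ⟨t, ht, rfl⟩ := h
    rw [Finset.sum_eq_single_of_mem t (Finset.mem_range.2 ht)]
    · simp
    · intro b _ hb
      exact Finsupp.single_eq_of_ne (by omega)
  · refine Finset.sum_eq_zero fun t ht => Finsupp.single_eq_of_ne fun h' => h ⟨t, ?_, h'⟩
    exact Finset.mem_range.1 ht

theorem isOstrowskiDigits_alternatingDigits {v : ℝ} (hv : Irrational v) (s L : ℕ) :
    IsOstrowskiDigits v (alternatingDigits v s L) where
  zero_lt := by
    rw [alternatingDigits_apply, if_neg (by rintro ⟨t, -, h⟩; omega)]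
    exact one_le_cfDigit hv 0
  le_digit n := by
    rw [alternatingDigits_apply]
    split_ifs <;> simp
  eq_zero_of_eq_digit n h := by
    rw [alternatingDigits_apply] at h
    split_ifs at h with h1
    · obtain ⟨t, ht, h1⟩ := h1
      rw [alternatingDigits_apply, if_neg]
      rintro ⟨t', -, h2⟩
      omega
    · have := one_le_cfDigit hv (n + 1)
      omega

/-- Each maximal digit contributes, up to a common sign, `β_{s+2t} - β_{s+2t+2}`, so the sum
telescopes. -/
theorem sum_alternatingDigits {v : ℝ} (hv : Irrational v) (s L : ℕ) :
    (((alternatingDigits v s L).sum (fun i d => d * cfDen v i) * Int.fract v : ℝ) :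
      UnitAddCircle) = ((-1) ^ (s + 1) * (cfRemainder v s - cfRemainder v (s + 2 * L)) : ℝ) := by
  have h1 : (alternatingDigits v s L).sum (fun i d => d * cfDen v i) =
      ∑ t ∈ Finset.range L, cfDigit v (s + 1 + 2 * t) * cfDen v (s + 1 + 2 * t) := by
    rw [alternatingDigits, ← Finsupp.sum_finsetSum_index (by simp) (by simp [add_mul])]
    simp
  have h2 : ((-1) ^ (s + 1) * (cfRemainder v s - cfRemainder v (s + 2 * L)) : ℝ) =
      ∑ t ∈ Finset.range L, (cfDigit v (s + 1 + 2 * t) : ℝ) *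
        ((-1) ^ (s + 1 + 2 * t) * cfRemainder v (s + 1 + 2 * t)) := by
    clear h1
    induction L with
    | zero => simp
    | succ L ih =>
      have := cfDigit_mul_cfRemainder hv (s + 2 * L)
      rw [Finset.sum_range_succ, ← ih, pow_add _ _ (2 * L), pow_mul]
      rw [show s + 2 * L + 1 = s + 1 + 2 * L by ring, show s + 2 * L + 2 = s + 2 * (L + 1) by ring]
        at this
      norm_num
      linear_combination -(-1) ^ (s + 1) * this
  rw [h1, h2]
  choose p hp using exists_cfDen_mul_sub hv
  refine unitAddCircle_coe_eq_iff.2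
    ⟨∑ t ∈ Finset.range L, cfDigit v (s + 1 + 2 * t) * p (s + 1 + 2 * t), ?_⟩
  push_cast
  rw [Finset.sum_mul, ← Finset.sum_add_distrib]
  refine Finset.sum_congr rfl fun i _ => ?_
  rw [← hp]
  ring

/-- The two choices `s = m'` and `s = m' + 1` for the tail starting at `m' + 1` show that both ends
of the arc bounding that tail are attained in the closure. -/
theorem alternating_limit_mem_closure {v : ℝ} (hv : Irrational v) {m s : ℕ} (hms : m ≤ s + 1) :
    (((-1) ^ (s + 1) * cfRemainder v s : ℝ) : UnitAddCircle) ∈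
      closure ((fun n : ℕ => ((n * Int.fract v : ℝ) : UnitAddCircle)) '' ostrowskiTail v m) := by
  have h0 : Tendsto (fun L => cfRemainder v (s + 2 * L)) atTop (𝓝 0) :=
    (tendsto_cfRemainder hv).comp (tendsto_atTop_mono (fun L => show L ≤ s + 2 * L by omega) tendsto_id)
  have h1 : Tendsto (fun L => ((-1) ^ (s + 1) * (cfRemainder v s - cfRemainder v (s + 2 * L)) : ℝ))
      atTop (𝓝 ((-1) ^ (s + 1) * (cfRemainder v s - 0))) :=
    (tendsto_const_nhds.sub h0).const_mul _
  rw [sub_zero] at h1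
  have h2 := ((AddCircle.continuous_mk' 1).tendsto _).comp h1
  refine mem_closure_of_tendsto h2 (Eventually.of_forall fun L => ?_)
  refine ⟨_, ⟨alternatingDigits v s L, isOstrowskiDigits_alternatingDigits hv s L, ?_, rfl⟩, ?_⟩
  · intro i hi
    rw [alternatingDigits_apply, if_neg]
    rintro ⟨t, -, h⟩
    omega
  · exact sum_alternatingDigits hv s L

/-- An arc that is contained in another arc, and contains both of its endpoints, has the same
length. -/
theorem length_eq_of_image_Icc {a b u w : ℝ} (hab : a ≤ b) (hw : w < u + 1)
    (hsub : ∀ t ∈ Set.Icc a b, ∃ s ∈ Set.Icc u w, (t : UnitAddCircle) = s)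
    (hu : ∃ t ∈ Set.Icc a b, (t : UnitAddCircle) = u)
    (hv : ∃ t ∈ Set.Icc a b, (t : UnitAddCircle) = w) : b - a = w - u := by
  simp only [unitAddCircle_coe_eq_iff] at hsub hu hv
  -- The translate `[u + k, w + k]` is the last one starting at or before `a`; it will turn out to
  -- equal `[a, b]`.
  set k := ⌊a - u⌋ with hk
  have hk1 : (k : ℝ) ≤ a - u := Int.floor_le _
  have hk2 : a - u < k + 1 := Int.lt_floor_add_one _
  have haw : a ≤ w + k := by
    obtain ⟨s, hs, n, hn⟩ := hsub a ⟨le_rfl, hab⟩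
    have : (n : ℝ) < k + 1 := by linarith [hs.1]
    have : n < k + 1 := by exact_mod_cast this
    have : (n : ℝ) ≤ k := by exact_mod_cast (by omega : n ≤ k)
    linarith [hs.2]
  have hbw : b ≤ w + k := by
    by_contra! hb
    -- If `b` overshot `w + k`, this point of `[a, b]` would lie in the gap between consecutive
    -- translates of `[u, w]`.
    set t := min b ((w + k + (u + k + 1)) / 2)
    have ht1 : t ≤ (w + k + (u + k + 1)) / 2 := min_le_right _ _
    have ht2 : w + k < t := lt_min hb (by linarith)
    obtain ⟨s, hs, n, hn⟩ := hsub t ⟨by linarith, min_le_left _ _⟩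
    have : (n : ℝ) < k + 1 := by linarith [hs.1]
    have : n < k + 1 := by exact_mod_cast this
    have : (n : ℝ) ≤ k := by exact_mod_cast (by omega : n ≤ k)
    linarith [hs.2]
  obtain ⟨s, hs, n, hn⟩ := hu
  obtain ⟨s', hs', n', hn'⟩ := hv
  have h1 : a ≤ u + k := by
    have : (n : ℝ) < k + 1 := by linarith [hs.2]
    have : n < k + 1 := by exact_mod_cast this
    have : (n : ℝ) ≤ k := by exact_mod_cast (by omega : n ≤ k)
    linarith [hs.1]
  have h2 : w + k ≤ b := by
    have : (k : ℝ) < n' + 1 := by linarith [hs'.1]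
    have : k < n' + 1 := by exact_mod_cast this
    have : (k : ℝ) ≤ n' := by exact_mod_cast (by omega : k ≤ n')
    linarith [hs'.2]
  linarith

/-- Greedy expansion. It is needed only in the degenerate case `a₁ = 1`, `m = 1`, where the arc is
the whole circle. -/
theorem exists_isOstrowskiDigits {v : ℝ} (hv : Irrational v) (M n : ℕ) (hn : n < cfDen v M) :
    ∃ c : ℕ →₀ ℕ, IsOstrowskiDigits v c ∧ (∀ i ≥ M, c i = 0) ∧
      n = c.sum fun i d => d * cfDen v i := by
  have hsum : ∀ (c : ℕ →₀ ℕ) i d, (c + Finsupp.single i d).sum (fun i d => d * cfDen v i) =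
      c.sum (fun i d => d * cfDen v i) + d * cfDen v i := by
    intro c i d
    rw [Finsupp.sum_add_index' (by simp) (by simp [add_mul]), Finsupp.sum_single_index (by simp)]
  have hd := one_le_cfDigit hv
  induction M using Nat.twoStepInduction generalizing n with
  | zero =>
    rw [cfDen_zero] at hn
    refine ⟨0, ⟨hd 0, fun _ => Nat.zero_le _, fun _ _ => rfl⟩, fun _ _ => rfl, ?_⟩
    simp only [Finsupp.sum_zero_index]
    omega
  | one =>
    rw [cfDen_one hv] at hn
    refine ⟨Finsupp.single 0 n, ⟨by simpa using hn, fun i => ?_, fun i h => ?_⟩, fun i hi => ?_, ?_⟩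
    · rw [Finsupp.single_apply]
      split_ifs with h
      · exact h ▸ hn.le
      · exact Nat.zero_le _
    · have := hd (i + 1)
      rw [Finsupp.single_eq_of_ne (by omega)] at h
      omega
    · exact Finsupp.single_eq_of_ne (by omega)
    · simp [cfDen_zero]
  | more M ih₁ ih₂ =>
    have hadd : ∀ (c : ℕ →₀ ℕ) d, IsOstrowskiDigits v c → (∀ i ≥ M + 1, c i = 0) →
        d ≤ cfDigit v (M + 1) → (d = cfDigit v (M + 1) → c M = 0) →
        IsOstrowskiDigits v (c + Finsupp.single (M + 1) d) ∧
          ∀ i ≥ M + 2, (c + Finsupp.single (M + 1) d) i = 0 := by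
      intro c d hc h0 hdle hdeq
      have hne : ∀ i, i ≠ M + 1 → (c + Finsupp.single (M + 1) d) i = c i := fun i hi => by
        rw [Finsupp.add_apply, Finsupp.single_eq_of_ne hi, add_zero]
      have heq : (c + Finsupp.single (M + 1) d) (M + 1) = d := by
        rw [Finsupp.add_apply, Finsupp.single_eq_same, h0 _ le_rfl, zero_add]
      refine ⟨⟨?_, fun i => ?_, fun i h => ?_⟩, fun i hi => ?_⟩
      · rw [hne 0 (by omega)]
        exact hc.zero_lt
      · by_cases hi : i = M + 1
        · rw [hi, heq]
          exact hdle
        · rw [hne i hi]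
          exact hc.le_digit i
      · by_cases hi : i = M
        · subst hi
          rw [heq] at h
          rw [hne i (by omega)]
          exact hdeq h
        · rw [hne (i + 1) (by omega)] at h
          by_cases hi' : i = M + 1
          · have := hd (i + 1)
            have := h0 (i + 1) (by omega)
            omega
          · rw [hne i hi']
            exact hc.eq_zero_of_eq_digit i h
      · rw [hne i (by omega)]
        exact h0 i (by omega)
    have hq := cfDen_pos hv (M + 1)
    rw [cfDen_add_two hv] at hn
    by_cases h : n < cfDigit v (M + 1) * cfDen v (M + 1)
    · obtain ⟨c, hc, h0, hc'⟩ := ih₂ (n % cfDen v (M + 1)) (Nat.mod_lt _ hq)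
      have hlt : n / cfDen v (M + 1) < cfDigit v (M + 1) := (Nat.div_lt_iff_lt_mul hq).2 h
      obtain ⟨h1, h2⟩ := hadd c (n / cfDen v (M + 1)) hc h0 hlt.le fun h => absurd h hlt.ne
      refine ⟨_, h1, h2, ?_⟩
      rw [hsum, ← hc', mul_comm]
      exact (Nat.mod_add_div _ _).symm
    -- When the leading digit is maximal the remainder is below `q_M`, so its expansion leaves place
    -- `M` empty, as admissibility demands.
    · obtain ⟨c, hc, h0, hc'⟩ := ih₁ (n - cfDigit v (M + 1) * cfDen v (M + 1)) (by omega)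
      obtain ⟨h1, h2⟩ := hadd c (cfDigit v (M + 1)) hc (fun i hi => h0 i (by omega)) le_rfl
        fun _ => h0 M le_rfl
      refine ⟨_, h1, h2, ?_⟩
      rw [hsum, ← hc']
      omega

theorem exists_lt_cfDen {v : ℝ} (hv : Irrational v) (n : ℕ) : ∃ M, n < cfDen v M := by
  have h : ∀ n, n < cfDen v (n + 2) := by
    intro n
    induction n with
    | zero => exact cfDen_pos hv _
    | succ n ih =>
      have h1 := cfDen_add_two hv (n + 1)
      have h2 := cfDen_pos hv (n + 1)
      have h3 := Nat.mul_le_mul_right (cfDen v (n + 1 + 1)) (one_le_cfDigit hv (n + 1 + 1))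
      rw [show n + 1 + 1 = n + 2 from rfl] at h1 h3
      omega
  exact ⟨_, h n⟩

theorem ostrowskiTail_one_eq_univ {v : ℝ} (hv : Irrational v) (h1 : cfDigit v 0 = 1) :
    ostrowskiTail v 1 = Set.univ := by
  refine Set.eq_univ_of_forall fun n => ?_
  obtain ⟨M, hM⟩ := exists_lt_cfDen hv n
  obtain ⟨c, hc, -, h⟩ := exists_isOstrowskiDigits hv M n hM
  refine ⟨c, hc, fun i hi => ?_, h⟩
  obtain rfl : i = 0 := by omega
  have := hc.zero_lt
  omega

theorem dense_natCast_mul {v : ℝ} (hv : Irrational v) :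
    DenseRange fun n : ℕ => ((n * v : ℝ) : UnitAddCircle) := by
  have h := denseRange_zsmul_iff_nsmul.1
    ((AddCircle.denseRange_zsmul_coe_iff (a := v) (p := 1)).2 (by simpa using hv))
  convert h using 2 with n
  rw [← AddCircle.coe_nsmul, nsmul_eq_mul]

/-- Outside the degenerate case the arc does not close up around the circle, so its length can be
read off from its endpoints. -/
theorem cfRemainder_add_lt_one {v : ℝ} (hv : Irrational v) {m : ℕ}
    (h : ¬ (m = 0 ∧ cfDigit v 0 = 1)) : cfRemainder v m + cfRemainder v (m + 1) < 1 := by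
  have h0 := cfRemainder_pos hv 0
  have h1 : cfRemainder v 0 < 1 := cfRemainder_zero v ▸ Int.fract_lt_one v
  rcases m with _ | m
  · have h2 : (2 : ℝ) ≤ cfDigit v 0 := by
      have := one_le_cfDigit hv 0
      exact_mod_cast (by omega : 2 ≤ cfDigit v 0)
    have := cfDigit_mul_cfRemainder_zero hv
    rw [zero_add]
    nlinarith
  · have := antitone_cfRemainder hv (Nat.zero_le m)
    exact ((cfRemainder_add_succ_le hv m).trans this).trans_lt h1

/-- The length of a special interval lies in `ℤ + ℤ α`. -/
theorem exists_length_specialInterval {α : ℝ} (hα : Irrational α) {m : ℕ} (hm : 1 ≤ m)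
    {γ : UnitAddCircle} {a b : ℝ} (hab : a < b) (hba : b ≤ a + 1)
    (h : (fun t : ℝ => (t : UnitAddCircle)) '' Set.Icc a b = specialInterval (Int.fract α) m γ) :
    ∃ r s : ℤ, b - a = r + s * α := by
  obtain ⟨m, rfl⟩ : ∃ m', m = m' + 1 := ⟨m - 1, by omega⟩
  set v := Int.fract α with hvdef
  have hv : Irrational v := irrational_fract hα
  have hfv : Int.fract v = v := Int.fract_fract α
  by_cases hcase : m = 0 ∧ cfDigit v 0 = 1
  · obtain ⟨rfl, h1⟩ := hcase
    refine ⟨1, 0, ?_⟩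
    have huniv : specialInterval v (0 + 1) γ = Set.univ := by
      rw [specialInterval, ostrowskiTail_one_eq_univ hv h1, Set.image_univ,
        (dense_natCast_mul hv).closure_range, Set.image_univ]
      exact Function.Surjective.range_eq fun y => ⟨y - γ, by simp⟩
    by_contra! hne
    have hlt : b < a + 1 := lt_of_le_of_ne hba fun h => hne (by rw [h]; simp)
    have hmem : (((b + (a + 1)) / 2 : ℝ) : UnitAddCircle) ∈
        (fun t : ℝ => (t : UnitAddCircle)) '' Set.Icc a b := by
      rw [h, huniv]
      trivial
    obtain ⟨t, ht, hteq⟩ := hmem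
    obtain ⟨n, hn⟩ := unitAddCircle_coe_eq_iff.1 hteq
    have h2 : (n : ℝ) < 0 := by linarith [ht.2]
    have h3 : (-1 : ℝ) < n := by linarith [ht.1]
    have h2 : n < 0 := by exact_mod_cast h2
    have h3 : -1 < n := by exact_mod_cast h3
    omega
  · have hlt := cfRemainder_add_lt_one hv hcase
    obtain ⟨g, rfl⟩ := QuotientAddGroup.mk_surjective γ
    obtain ⟨p₁, hp₁⟩ := exists_cfDen_mul_sub hv m
    obtain ⟨p₂, hp₂⟩ := exists_cfDen_mul_sub hv (m + 1)
    set ε : ℝ := (-1) ^ (m + 1) with hε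
    have hε2 : ε = 1 ∨ ε = -1 := neg_one_pow_eq_or ℝ (m + 1)
    set β₀ := cfRemainder v m
    set β₁ := cfRemainder v (m + 1)
    have hmem₀ : ((g + ε * β₀ : ℝ) : UnitAddCircle) ∈ specialInterval v (m + 1) (g : ℝ) := by
      have := alternating_limit_mem_closure hv (m := m + 1) (s := m) le_rfl
      rw [hfv] at this
      exact ⟨_, this, (AddCircle.coe_add _ _ _).symm⟩
    have hmem₁ : ((g + ε * -β₁ : ℝ) : UnitAddCircle) ∈ specialInterval v (m + 1) (g : ℝ) := by
      have := alternating_limit_mem_closure hv (m := m + 1) (s := m + 1) (by omega)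
      rw [hfv] at this
      refine ⟨_, this, ?_⟩
      refine (AddCircle.coe_add _ _ _).symm.trans ?_
      rw [pow_succ]
      congr 1
      ring
    have hsub : ∀ y ∈ specialInterval v (m + 1) (g : ℝ), ∃ t ∈ Set.Icc (-β₁) β₀,
        y = ((g + ε * t : ℝ) : UnitAddCircle) := by
      rintro _ ⟨y, hy, rfl⟩
      have hcl : IsClosed ((fun t : ℝ => ((ε * t : ℝ) : UnitAddCircle)) '' Set.Icc (-β₁) β₀) := by
        refine (isCompact_Icc.image ?_).isClosed
        exact (AddCircle.continuous_mk' 1).comp (continuous_const.mul continuous_id)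
      have : y ∈ (fun t : ℝ => ((ε * t : ℝ) : UnitAddCircle)) '' Set.Icc (-β₁) β₀ := by
        refine closure_minimal ?_ hcl hy
        rintro _ ⟨n, hn, rfl⟩
        obtain ⟨t, ht, hteq⟩ := image_ostrowskiTail_subset hv m hn
        rw [hfv] at hteq
        exact ⟨t, ht, hteq.symm⟩
      obtain ⟨t, ht, rfl⟩ := this
      exact ⟨t, ht, (AddCircle.coe_add _ _ _).symm⟩
    rw [← h] at hmem₀ hmem₁ hsub
    obtain ⟨t₀, ht₀, hmem₀⟩ := hmem₀
    obtain ⟨t₁, ht₁, hmem₁⟩ := hmem₁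
    have hlen : b - a = β₀ + β₁ := by
      rcases hε2 with hε2 | hε2
      · rw [length_eq_of_image_Icc (u := g - β₁) (w := g + β₀) hab.le (by linarith) ?_
          ⟨t₁, ht₁, ?_⟩ ⟨t₀, ht₀, ?_⟩]
        · ring
        · intro t ht
          obtain ⟨s, hs, hts⟩ := hsub _ ⟨t, ht, rfl⟩
          exact ⟨g + s, ⟨by linarith [hs.1], by linarith [hs.2]⟩, by simpa [hε2] using hts⟩
        · rw [hε2] at hmem₁
          simpa [sub_eq_add_neg] using hmem₁
        · rw [hε2] at hmem₀
          simpa using hmem₀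
      · rw [length_eq_of_image_Icc (u := g - β₀) (w := g + β₁) hab.le (by linarith) ?_
          ⟨t₀, ht₀, ?_⟩ ⟨t₁, ht₁, ?_⟩]
        · ring
        · intro t ht
          obtain ⟨s, hs, hts⟩ := hsub _ ⟨t, ht, rfl⟩
          exact ⟨g - s, ⟨by linarith [hs.2], by linarith [hs.1]⟩,
            by simpa [hε2, sub_eq_add_neg] using hts⟩
        · rw [hε2] at hmem₀
          simpa [sub_eq_add_neg] using hmem₀
        · rw [hε2] at hmem₁
          simpa using hmem₁
    have hvα : v = α - ⌊α⌋ := rfl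
    rw [hfv] at hp₁ hp₂
    rw [show (-1 : ℝ) ^ m = -ε by rw [hε, pow_succ]; ring] at hp₁
    -- Both remainders are, up to sign, of the form `q v - p`. Their signs are opposite, so the sum
    -- `β₀ + β₁` is `ε` times a difference of two such forms.
    rcases hε2 with hε2 | hε2
    · refine ⟨p₁ - p₂ - (cfDen v (m + 1) - cfDen v m) * ⌊α⌋, cfDen v (m + 1) - cfDen v m, ?_⟩
      rw [hε2] at hp₁ hp₂
      push_cast
      linear_combination hlen + hp₁ - hp₂ + ((cfDen v (m + 1) : ℝ) - cfDen v m) * hvα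
    · refine ⟨p₂ - p₁ - (cfDen v m - cfDen v (m + 1)) * ⌊α⌋, cfDen v m - cfDen v (m + 1), ?_⟩
      rw [hε2] at hp₁ hp₂
      push_cast
      linear_combination hlen - hp₁ + hp₂ + ((cfDen v m : ℝ) - cfDen v (m + 1)) * hvα

/-! ### Families of group elements with values in a window -/

section Window

variable {G F : Type*} [AddCommGroup G] [NormedAddCommGroup F]

/-- The images under `ρ` of the group elements whose height `ψ` lies in `T`. -/
def levelFamily (ψ : G →+ ℝ) (ρ : G →+ F) (T : Set ℝ) : {n : G // ψ n ∈ T} → F := fun n => ρ n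

/-- Hilbert's hotel: elements at height `e t` move to height `e (t + 1)` by adding `v t`, which
vacates the height `e 0`. -/
theorem familyBD_levelFamily_diff_singleton (ψ : G →+ ℝ) (ρ : G →+ F) {T : Set ℝ} (e : ℕ → ℝ)
    (he : Function.Injective e) (heT : ∀ t, e t ∈ T) (v : ℕ → G)
    (hv : ∀ t, ψ (v t) = e (t + 1) - e t) (C : ℝ) (hC : ∀ t, ‖ρ (v t)‖ ≤ C) :
    FamilyBD (levelFamily ψ ρ T) (levelFamily ψ ρ (T \ {e 0})) := by
  classical
  let f : G → G := fun n => if h : ∃ t, ψ n = e t then n + v h.choose else n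
  have f1 : ∀ n t, ψ n = e t → f n = n + v t := by
    intro n t h
    have hex : ∃ t, ψ n = e t := ⟨t, h⟩
    have : hex.choose = t := he (hex.choose_spec.symm.trans h)
    simp only [f, dif_pos hex, this]
  have f2 : ∀ n, (¬ ∃ t, ψ n = e t) → f n = n := fun n h => by simp only [f, dif_neg h]
  have f3 : ∀ n t, ψ n = e t → ψ (f n) = e (t + 1) := fun n t h => by
    rw [f1 n t h, map_add, hv, h]
    ring
  have hfT : ∀ n, ψ n ∈ T → ψ (f n) ∈ T \ {e 0} := by
    intro n hn
    by_cases h : ∃ t, ψ n = e t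
    · obtain ⟨t, ht⟩ := h
      rw [f3 n t ht]
      exact ⟨heT _, fun h => absurd (he h) (Nat.succ_ne_zero t)⟩
    · rw [f2 n h]
      exact ⟨hn, fun h' => h ⟨0, h'⟩⟩
  let g : {n : G // ψ n ∈ T} → {n : G // ψ n ∈ T \ {e 0}} := fun n => ⟨f n, hfT n n.2⟩
  have hg : Function.Bijective g := by
    constructor
    · rintro ⟨n, hn⟩ ⟨n', hn'⟩ h
      have h : f n = f n' := congrArg Subtype.val h
      refine Subtype.ext ?_
      change n = n'
      by_cases h1 : ∃ t, ψ n = e t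
      · obtain ⟨t, ht⟩ := h1
        by_cases h2 : ∃ t, ψ n' = e t
        · obtain ⟨t', ht'⟩ := h2
          have h3 := f3 n t ht
          rw [h, f3 n' t' ht'] at h3
          obtain rfl : t' = t := by simpa using he h3
          rw [f1 n _ ht, f1 n' _ ht'] at h
          exact add_right_cancel h
        · have h3 := f3 n t ht
          rw [h, f2 n' h2] at h3
          exact absurd ⟨_, h3⟩ h2
      · by_cases h2 : ∃ t, ψ n' = e t
        · obtain ⟨t, ht⟩ := h2
          have h3 := f3 n' t ht
          rw [← h, f2 n h1] at h3
          exact absurd ⟨_, h3⟩ h1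
        · rwa [f2 n h1, f2 n' h2] at h
    · rintro ⟨y, hy, hy0⟩
      by_cases h : ∃ t, ψ y = e t
      · obtain ⟨t, ht⟩ := h
        rcases t with _ | t
        · exact absurd ht hy0
        · have h1 : ψ (y - v t) = e t := by
            rw [map_sub, ht, hv]
            ring
          refine ⟨⟨y - v t, h1 ▸ heT t⟩, Subtype.ext ?_⟩
          change f (y - v t) = y
          rw [f1 _ t h1, sub_add_cancel]
      · exact ⟨⟨y, hy⟩, Subtype.ext (f2 y h)⟩
  refine ⟨Equiv.ofBijective g hg, C, ?_⟩
  rintro ⟨n, hn⟩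
  change ‖ρ n - ρ (f n)‖ ≤ C
  have hC0 : 0 ≤ C := (norm_nonneg _).trans (hC 0)
  by_cases h : ∃ t, ψ n = e t
  · obtain ⟨t, ht⟩ := h
    rw [f1 n t ht, map_add, sub_add_cancel_left, norm_neg]
    exact hC t
  · rw [f2 n h, sub_self, norm_zero]
    exact hC0

theorem familyBD_levelFamily_diff_endpoint [NormedSpace ℝ F] (ψ : G →+ ℝ) (ρ : G →+ F) {u z : G} (hu : 0 < ψ u)
    (hz : Irrational (ψ z / ψ u)) {T : Set ℝ} {c : ℝ} (hT : Set.Ioo c (c + ψ u) ⊆ T) (δ : ℤ)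
    (hδ : δ = 0 ∨ δ = 1) :
    FamilyBD (levelFamily ψ ρ T) (levelFamily ψ ρ (T \ {c + ψ u * δ})) := by
  by_cases hmem : c + ψ u * δ ∈ T
  swap
  · rw [Set.sdiff_singleton_eq_self hmem]
    exact .refl _
  set β := ψ z / ψ u with hβ
  have hzβ : ψ z = ψ u * β := by rw [hβ]; field_simp
  -- For `t > 0` the heights `e t` follow the rotation by `β` inside the window, and irrationality
  -- keeps them distinct and off the endpoints. The value `K 0 = -δ` starts the sequence at the
  -- endpoint to be removed.
  let K : ℕ → ℤ := fun t => if t = 0 then -δ else ⌊t * β⌋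
  have hK : ∀ t, |t * β - K t| ≤ 1 := by
    intro t
    by_cases ht : t = 0
    · rcases hδ with rfl | rfl <;> simp [K, ht]
    · simp only [K, if_neg ht]
      rw [abs_le]
      constructor <;> linarith [Int.floor_le (t * β), Int.lt_floor_add_one (t * β)]
  let e : ℕ → ℝ := fun t => c + ψ u * (t * β - K t)
  have he0 : e 0 = c + ψ u * δ := by simp [e, K]
  rw [← he0]
  refine familyBD_levelFamily_diff_singleton ψ ρ e ?_ ?_
    (fun t => z - (K (t + 1) - K t) • u) ?_ (‖ρ z‖ + (|β| + 2) * ‖ρ u‖) ?_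
  · intro t s hts
    have h1 : (t * β - K t) = (s * β - K s) := by
      have := add_left_cancel hts
      exact mul_left_cancel₀ hu.ne' this
    by_contra hne
    have hne' : ((t : ℤ) - s) ≠ 0 := by omega
    refine (hz.intCast_mul hne').ne_int (K t - K s) ?_
    push_cast
    linarith
  · intro t
    by_cases ht : t = 0
    · rw [ht, he0]
      exact hmem
    · apply hT
      simp only [e, K, if_neg ht]
      have h1 := Int.floor_le (t * β)
      have h2 := Int.lt_floor_add_one (t * β)
      have h3 : (t * β) ≠ ⌊t * β⌋ := (hz.natCast_mul ht).ne_int _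
      have h4 : 0 < t * β - ⌊t * β⌋ := by
        rw [sub_pos]
        exact lt_of_le_of_ne h1 h3.symm
      constructor <;> nlinarith
  · intro t
    rw [map_sub, map_zsmul, zsmul_eq_mul, hzβ]
    simp only [e]
    push_cast
    ring
  · intro t
    have h1 := abs_le.1 (hK t)
    have h2 := abs_le.1 (hK (t + 1))
    push_cast at h2
    have h3 : |((K (t + 1) - K t : ℤ) : ℝ)| ≤ |β| + 2 := by
      push_cast
      rw [abs_le]
      constructor <;> linarith [le_abs_self β, neg_abs_le β]
    rw [map_sub, map_zsmul]
    refine (norm_sub_le _ _).trans (add_le_add_right ?_ _)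
    rw [← Int.cast_smul_eq_zsmul ℝ, norm_smul, Real.norm_eq_abs]
    gcongr

/-- Whether or not the endpoints belong to the window does not matter. -/
theorem familyBD_levelFamily_Ico [NormedSpace ℝ F] (ψ : G →+ ℝ) (ρ : G →+ F) {u z : G} (hu : 0 < ψ u)
    (hz : Irrational (ψ z / ψ u)) {T : Set ℝ} {c : ℝ} (hT : Set.Ioo c (c + ψ u) ⊆ T)
    (hT' : T ⊆ Set.Icc c (c + ψ u)) :
    FamilyBD (levelFamily ψ ρ T) (levelFamily ψ ρ (Set.Ico c (c + ψ u))) := by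
  have key : ∀ T : Set ℝ, Set.Ioo c (c + ψ u) ⊆ T → T ⊆ Set.Icc c (c + ψ u) →
      FamilyBD (levelFamily ψ ρ T) (levelFamily ψ ρ (Set.Ioo c (c + ψ u))) := by
    intro T hT hT'
    have h1 := familyBD_levelFamily_diff_endpoint ψ ρ hu hz hT 0 (Or.inl rfl)
    have hT1 : Set.Ioo c (c + ψ u) ⊆ T \ {c + ψ u * ((0 : ℤ) : ℝ)} := fun x hx =>
      ⟨hT hx, fun h => by simp at h; exact hx.1.ne' h⟩
    have h2 := familyBD_levelFamily_diff_endpoint ψ ρ hu hz hT1 1 (Or.inr rfl)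
    have heq : (T \ {c + ψ u * ((0 : ℤ) : ℝ)}) \ {c + ψ u * ((1 : ℤ) : ℝ)} =
        Set.Ioo c (c + ψ u) := by
      refine Set.Subset.antisymm ?_ fun x hx => ⟨hT1 hx, fun h => ?_⟩
      · rintro x ⟨⟨hx, h0⟩, h1⟩
        simp only [Int.cast_zero, mul_zero, add_zero, Int.cast_one, mul_one,
          Set.mem_singleton_iff] at h0 h1
        exact ⟨lt_of_le_of_ne (hT' hx).1 (Ne.symm h0), lt_of_le_of_ne (hT' hx).2 h1⟩
      · simp at h
        exact hx.2.ne h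
    rw [heq] at h2
    exact h1.trans h2
  exact (key T hT hT').trans (key _ Set.Ioo_subset_Ico_self Set.Ico_subset_Icc_self).symm

/-- Two sets of representatives modulo `ℤ u` have the same images under maps that kill `u`. -/
theorem familyBD_of_transversals (ρ : G →+ F) {u : G} (hρ : ρ u = 0) {P B : Set G}
    (hP : ∀ n, ∃! m : ℤ, n + m • u ∈ P) (hB : ∀ n, ∃! m : ℤ, n + m • u ∈ B) :
    FamilyBD (fun n : P => ρ n) (fun n : B => ρ n) := by
  choose p hp hp' using hP
  choose b hb hb' using hB
  simp only at hp hp' hb hb'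
  refine .of_equiv ⟨fun n => ⟨_, hb n⟩, fun n => ⟨_, hp n⟩, fun n => ?_, fun n => ?_⟩ fun n => ?_
  · refine Subtype.ext ?_
    change (n : G) + b n • u + p (n + b n • u) • u = n
    have : p (n + b n • u) = - b n := (hp' _ _ (by simp)).symm
    rw [this]
    simp
  · refine Subtype.ext ?_
    change (n : G) + p n • u + b (n + p n • u) • u = n
    have : b (n + p n • u) = - p n := (hb' _ _ (by simp)).symm
    rw [this]
    simp
  · simp [hρ]

theorem existsUnique_map_add_zsmul_mem_Ico (ψ : G →+ ℝ) {u : G} (hu : 0 < ψ u) (c : ℝ) (n : G) :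
    ∃! m : ℤ, ψ (n + m • u) ∈ Set.Ico c (c + ψ u) := by
  simpa [map_add, map_zsmul] using existsUnique_add_zsmul_mem_Ico hu (ψ n) c

end Window

/-! ### Projections along a vector onto a hyperplane -/

section Proj

variable {E : Type*} [AddCommGroup E] [Module ℝ E] {V : Submodule ℝ E} (φ : E →ₗ[ℝ] ℝ)
  (hφ : LinearMap.ker φ = V)

/-- The projection along `u` onto the kernel `V` of a linear functional. -/
def projAlong (u : E) (hu : φ u ≠ 0) : E →ₗ[ℝ] V :=
  LinearMap.codRestrict V (LinearMap.id - φ.smulRight ((φ u)⁻¹ • u)) fun y => by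
    rw [← hφ, LinearMap.mem_ker]
    simp [hu]

theorem coe_projAlong (u : E) (hu : φ u ≠ 0) (y : E) :
    (projAlong φ hφ u hu y : E) = y - (φ y * (φ u)⁻¹) • u := by
  simp [projAlong, mul_smul]

theorem projAlong_self (u : E) (hu : φ u ≠ 0) : projAlong φ hφ u hu u = 0 := by
  refine Subtype.ext ?_
  rw [coe_projAlong, mul_inv_cancel₀ hu]
  simp

theorem projAlong_eq_zero_iff (u : E) (hu : φ u ≠ 0) (y : E) :
    projAlong φ hφ u hu y = 0 ↔ y = (φ y * (φ u)⁻¹) • u := by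
  rw [← Subtype.coe_inj, coe_projAlong, Submodule.coe_zero, sub_eq_zero]

/-- The discrepancy depends on `y` only through `φ y`. Hence the direction of projection can be
changed at bounded cost on vectors of bounded height. -/
theorem projAlong_sub_projAlong (u w : E) (hu : φ u ≠ 0) (hw : φ w ≠ 0) (y : E) :
    projAlong φ hφ w hw y - projAlong φ hφ u hu y = (φ y * (φ u)⁻¹) • projAlong φ hφ w hw u := by
  refine Subtype.ext ?_
  rw [Submodule.coe_sub, Submodule.coe_smul, coe_projAlong, coe_projAlong, coe_projAlong,
    smul_sub, smul_smul, sub_sub_sub_cancel_left]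
  congr 2
  field_simp

end Proj

/-! ### Integer vectors -/

/-- An integer vector, as a vector of the Euclidean space. -/
def intVec (k : ℕ) : (Fin k → ℤ) →+ EuclideanSpace ℝ (Fin k) where
  toFun n := WithLp.toLp 2 fun i => (n i : ℝ)
  map_zero' := by ext; simp
  map_add' a b := by ext; simp

@[simp]
theorem intVec_apply {k : ℕ} (n : Fin k → ℤ) (i : Fin k) : intVec k n i = n i := rfl

theorem intVec_injective (k : ℕ) : Function.Injective (intVec k) := fun a b h => by
  ext i
  have := congrArg (fun v : EuclideanSpace ℝ (Fin k) => v i) h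
  simpa using this

theorem intVec_single {k : ℕ} (i : Fin k) :
    intVec k (Pi.single i 1) = EuclideanSpace.single i (1 : ℝ) := by
  ext l
  by_cases h : l = i
  · subst h; simp
  · simp [h]

/-! ### Projected integer vectors with height in a window -/

section Family

variable {d : ℕ} {V : Submodule ℝ (EuclideanSpace ℝ (Fin (d + 1)))}
  (φ : EuclideanSpace ℝ (Fin (d + 1)) →ₗ[ℝ] ℝ) (hφ : LinearMap.ker φ = V)

theorem existsUnique_add_mul_mem_Ico_abs {a : ℤ} (ha : a ≠ 0) (n : ℤ) :
    ∃! m : ℤ, n + m * a ∈ Set.Ico 0 |a| := by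
  rcases lt_or_gt_of_ne ha with h | h
  · obtain ⟨m, hm, hm'⟩ := existsUnique_add_zsmul_mem_Ico (neg_pos.2 h) n 0
    simp only [smul_eq_mul, zero_add] at hm hm'
    rw [abs_of_neg h]
    refine ⟨-m, by simpa using hm, fun m' h' => ?_⟩
    rw [← hm' (-m') (by simpa using h'), neg_neg]
  · simpa [abs_of_pos h] using existsUnique_add_zsmul_mem_Ico h n 0

/-- Integer vectors whose `j`-th coordinate is fixed project onto a translate of a lattice. -/
theorem exists_familyBD_insertNth {u : EuclideanSpace ℝ (Fin (d + 1))} (hu : φ u ≠ 0)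
    {j : Fin (d + 1)} (hj : u j ≠ 0) (κ : V →ₗ[ℝ] (Fin d → ℝ)) (hκ : Function.Injective κ)
    (o : Fin d) (t : ℤ) :
    ∃ c > 0, FamilyBD
      (fun m : Fin d → ℤ => κ (projAlong φ hφ u hu (intVec (d + 1) (j.insertNth t m))))
      (latticePoint (stretch o c)) := by
  let ins : (Fin d → ℝ) →ₗ[ℝ] EuclideanSpace ℝ (Fin (d + 1)) :=
    { toFun := fun y => WithLp.toLp 2 (j.insertNth (0 : ℝ) y)
      map_add' := fun a b => by
        ext i
        induction i using Fin.succAboveCases j <;> simp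
      map_smul' := fun a b => by
        ext i
        induction i using Fin.succAboveCases j <;> simp }
  have insj : ∀ y, ins y j = 0 := fun y => by simp [ins]
  have inss : ∀ y i, ins y (j.succAbove i) = y i := fun y i => by simp [ins]
  let L : (Fin d → ℝ) →ₗ[ℝ] (Fin d → ℝ) := κ ∘ₗ projAlong φ hφ u hu ∘ₗ ins
  -- The kernel of the projection is the line through `u`, which meets the hyperplane of vanishing
  -- `j`-th coordinate only in `0`.
  have hL : (LinearMap.toMatrix' L).det ≠ 0 := by
    intro h
    obtain ⟨y, hy, h⟩ := Matrix.exists_mulVec_eq_zero_iff.2 h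
    rw [LinearMap.toMatrix'_mulVec] at h
    apply hy
    have h1 : projAlong φ hφ u hu (ins y) = 0 := hκ (by rw [map_zero]; exact h)
    rw [projAlong_eq_zero_iff] at h1
    have h2 : ins y j = _ := congrArg (fun v : EuclideanSpace ℝ (Fin (d + 1)) => v j) h1
    rw [insj, PiLp.smul_apply, smul_eq_mul, eq_comm, mul_eq_zero, or_iff_left hj] at h2
    rw [h2, zero_smul] at h1
    ext i
    rw [show y i = ins y (j.succAbove i) from (inss y i).symm, h1]
    rfl
  obtain ⟨c, hc, h⟩ := exists_familyBD_stretch o _ hL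
  refine ⟨c, hc, .trans (.of_bounded
    ‖κ (projAlong φ hφ u hu (intVec (d + 1) (Pi.single j t)))‖ fun m => ?_) h⟩
  rw [latticePoint, LinearMap.toMatrix'_mulVec]
  change ‖κ (projAlong φ hφ u hu (intVec (d + 1) (j.insertNth t m))) -
    κ (projAlong φ hφ u hu (ins fun i => (m i : ℝ)))‖ ≤ _
  rw [← map_sub, ← map_sub]
  apply le_of_eq
  congr 3
  ext i
  induction i using Fin.succAboveCases j <;> simp [ins]

/-- The height of an integer vector. -/
def height : (Fin (d + 1) → ℤ) →+ ℝ := φ.toAddMonoidHom.comp (intVec (d + 1))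

theorem height_apply (n : Fin (d + 1) → ℤ) : height φ n = φ (intVec (d + 1) n) := rfl

/-- The projection of an integer vector along `w`, in coordinates on the hyperplane. -/
def projInt (w : EuclideanSpace ℝ (Fin (d + 1))) (hw : φ w ≠ 0) (κ : V →ₗ[ℝ] (Fin d → ℝ)) :
    (Fin (d + 1) → ℤ) →+ (Fin d → ℝ) :=
  (κ ∘ₗ projAlong φ hφ w hw).toAddMonoidHom.comp (intVec (d + 1))

theorem projInt_apply (w : EuclideanSpace ℝ (Fin (d + 1))) (hw : φ w ≠ 0)
    (κ : V →ₗ[ℝ] (Fin d → ℝ)) (n : Fin (d + 1) → ℤ) :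
    projInt φ hφ w hw κ n = κ (projAlong φ hφ w hw (intVec (d + 1) n)) := rfl

/-- Integer vectors in a window whose length is the height of an integer vector project to a
family that is close to a lattice. -/
theorem exists_familyBD_window {w : EuclideanSpace ℝ (Fin (d + 1))} (hw : φ w ≠ 0)
    (κ : V →ₗ[ℝ] (Fin d → ℝ)) (hκ : Function.Injective κ) (o : Fin d)
    {u z : Fin (d + 1) → ℤ} (hu : 0 < height φ u) (hz : Irrational (height φ z / height φ u))
    {T : Set ℝ} {c : ℝ} (hT : Set.Ioo c (c + height φ u) ⊆ T)
    (hT' : T ⊆ Set.Icc c (c + height φ u)) :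
    ∃ c' > 0, FamilyBD (levelFamily (height φ) (projInt φ hφ w hw κ) T)
      (latticePoint (stretch o c')) := by
  have hu' : φ (intVec (d + 1) u) ≠ 0 := hu.ne'
  obtain ⟨j, hj⟩ : ∃ j, u j ≠ 0 := by
    by_contra! h
    rw [show u = 0 from funext h, map_zero] at hu
    exact lt_irrefl _ hu
  have h1 := familyBD_levelFamily_Ico (height φ) (projInt φ hφ w hw κ) hu hz hT hT'
  set I := Set.Ico c (c + height φ u) with hI
  let ρ := projInt φ hφ (intVec (d + 1) u) hu' κ
  have h2 : FamilyBD (levelFamily (height φ) (projInt φ hφ w hw κ) I)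
      (levelFamily (height φ) ρ I) := by
    refine .of_bounded ((|c| + height φ u) * (height φ u)⁻¹ *
      ‖κ (projAlong φ hφ w hw (intVec (d + 1) u))‖) ?_
    rintro ⟨n, hn⟩
    change ‖κ _ - κ _‖ ≤ _
    rw [← map_sub, projAlong_sub_projAlong, map_smul, norm_smul]
    refine mul_le_mul_of_nonneg_right ?_ (norm_nonneg _)
    change ‖height φ n * (height φ u)⁻¹‖ ≤ _
    rw [norm_mul, norm_inv, Real.norm_eq_abs, Real.norm_eq_abs, abs_of_pos hu]
    refine mul_le_mul_of_nonneg_right ?_ (inv_nonneg.2 hu.le)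
    rw [abs_le]
    constructor <;> linarith [hn.1, hn.2, neg_abs_le c, le_abs_self c]
  have hρu : ρ u = 0 := by
    change κ _ = 0
    rw [projAlong_self, map_zero]
  -- A second transversal for `ℤ u`, sliced by the value of the `j`-th coordinate into `|u j|`
  -- translates of one copy of `ℤ^d`.
  let B : Set (Fin (d + 1) → ℤ) := {n | n j ∈ Set.Ico 0 |u j|}
  have h3 : FamilyBD (levelFamily (height φ) ρ I) (fun n : B => ρ n) :=
    familyBD_of_transversals ρ hρu (P := {n | height φ n ∈ I})
      (existsUnique_map_add_zsmul_mem_Ico (height φ) hu c)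
      (fun n => by simpa [B] using existsUnique_add_mul_mem_Ico_abs hj (n j))
  have habs : |u j| = ((u j).natAbs : ℤ) := Int.abs_eq_natAbs _
  have hN : 0 < (u j).natAbs := Int.natAbs_pos.2 hj
  obtain ⟨c', hc', h4⟩ := familyBD_sigma_stretch o hN
    (fun (t : Fin (u j).natAbs) (m : Fin d → ℤ) => ρ (j.insertNth (t : ℤ) m))
    (fun t => exists_familyBD_insertNth φ hφ hu' (j := j) (by simpa using hj) κ hκ o t)
  refine ⟨c', hc', h1.trans (h2.trans (h3.trans (.trans (.symm ?_) h4)))⟩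
  refine .of_equiv (Equiv.ofBijective (fun x => ⟨j.insertNth (x.1 : ℤ) x.2, ?_⟩) ⟨?_, ?_⟩)
    fun x => rfl
  · have := x.1.2
    simp only [B, Set.mem_ofPred_eq, Fin.insertNth_apply_same, Set.mem_Ico]
    omega
  · rintro ⟨t, m⟩ ⟨t', m'⟩ h
    have hins := congrArg Subtype.val h
    simp only [Fin.insertNth_inj, Nat.cast_inj] at hins
    obtain ⟨ht, rfl⟩ := hins
    obtain rfl := Fin.ext ht
    rfl
  · rintro ⟨n, hn⟩
    simp only [B, Set.mem_ofPred_eq, Set.mem_Ico] at hn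
    refine ⟨⟨⟨(n j).toNat, by omega⟩, j.removeNth n⟩, Subtype.ext ?_⟩
    simp [hn.1]

end Family

/-- This carries one irrational ratio of heights over to windows of any other length `c`. -/
theorem exists_irrational_div {x y c : ℝ} (hc : c ≠ 0) (h : Irrational (x / y)) :
    Irrational (x / c) ∨ Irrational (y / c) := by
  by_contra! hne
  simp only [Irrational, not_not] at hne
  obtain ⟨⟨q, hq⟩, ⟨r, hr⟩⟩ := hne
  refine h ⟨q / r, ?_⟩
  rw [Rat.cast_div, hq, hr, div_div_div_cancel_right₀ hc]

theorem Icc_subset_of_window {T : Set ℝ} {c l s t : ℝ} (hT : Set.Ioo c (c + l) ⊆ T)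
    (hT' : T ⊆ Set.Icc c (c + l)) (hs : s ∈ T) (ht : t ∈ T) : Set.Icc s t ⊆ T := by
  intro y hy
  rcases hy.1.eq_or_lt with rfl | h1
  · exact hs
  rcases hy.2.eq_or_lt with rfl | h2
  · exact ht
  exact hT ⟨(hT' hs).1.trans_lt h1, h2.trans_le (hT' ht).2⟩

theorem exists_functional {d : ℕ} {V : Submodule ℝ (EuclideanSpace ℝ (Fin (d + 1)))}
    (hV : Module.finrank ℝ V = d) {w : EuclideanSpace ℝ (Fin (d + 1))} (hw : w ∉ V) :
    ∃ φ : EuclideanSpace ℝ (Fin (d + 1)) →ₗ[ℝ] ℝ, LinearMap.ker φ = V ∧ φ w = 1 := by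
  obtain ⟨f, hfw, hf⟩ := Submodule.exists_le_ker_of_notMem hw
  refine ⟨(f w)⁻¹ • f, ?_, by simp [hfw]⟩
  rw [LinearMap.ker_smul _ _ (inv_ne_zero hfw)]
  refine (Submodule.eq_of_le_of_finrank_le hf ?_).symm
  have h1 := LinearMap.finrank_range_add_finrank_ker f
  have h2 : LinearMap.range f = ⊤ := LinearMap.range_eq_top.2
    (LinearMap.surjective fun h => hfw (by rw [h]; rfl))
  rw [h2, finrank_top, Module.finrank_self, finrank_euclideanSpace, Fintype.card_fin] at h1
  omega

/-! ### Windows of special intervals; injectivity and discreteness of the projection -/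

section Main

variable {d : ℕ} {V : Submodule ℝ (EuclideanSpace ℝ (Fin (d + 1)))}
  (φ : EuclideanSpace ℝ (Fin (d + 1)) →ₗ[ℝ] ℝ) (hφ : LinearMap.ker φ = V)

/-- The parameter set of a special interval on its line is an interval whose length is the height
of an integer vector. -/
theorem IsSpecialFor.exists_window {A : Set (EuclideanSpace ℝ (Fin (d + 1)))}
    (hA : IsSpecialFor V A) (hφ : LinearMap.ker φ = V) {p w : EuclideanSpace ℝ (Fin (d + 1))}
    (hw : φ w = 1) (hline : A ⊆ Set.range fun t : ℝ => p + t • w) (θ : ℝ) :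
    ∃ (u : Fin (d + 1) → ℤ) (c : ℝ), 0 < height φ u ∧
      Set.Ioo c (c + height φ u) ⊆ {h | p + (θ - h) • w ∈ A} ∧
      {h | p + (θ - h) • w ∈ A} ⊆ Set.Icc c (c + height φ u) := by
  obtain ⟨i, j, α, m, γ, a, b, -, hj, hi, hα, hm, hab, hba, himg, hsub, hsup⟩ := hA
  obtain ⟨r, s, hrs⟩ := exists_length_specialInterval hα hm hab hba himg
  have hmem : ∀ y, y ∈ V ↔ φ y = 0 := fun y => by rw [← hφ, LinearMap.mem_ker]
  rw [hmem] at hj hi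
  rw [map_add, map_smul, smul_eq_mul] at hi
  set q := φ (EuclideanSpace.single j 1) with hq
  -- Sliding parallel to `V` preserves `φ`, so `p + t • w` lands at the `h` with `h * q = φ p + t`.
  have hslide : ∀ h, h ∈ slideToAxis V j A ↔ p + (h * q - φ p) • w ∈ A := by
    intro h
    constructor
    · rintro ⟨y, hy, hyV⟩
      obtain ⟨t, rfl⟩ := hline hy
      rw [hmem, map_sub, map_add, map_smul, map_smul, hw, ← hq, smul_eq_mul, smul_eq_mul] at hyV
      rwa [show h * q - φ p = t by linarith]
    · intro hy
      refine ⟨_, hy, ?_⟩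
      rw [hmem, map_sub, map_add, map_smul, map_smul, hw, ← hq, smul_eq_mul, smul_eq_mul]
      ring
  have hconv : ∀ h, h ∈ {h | p + (θ - h) • w ∈ A} ↔ (θ - h + φ p) / q ∈ slideToAxis V j A := by
    intro h
    rw [hslide, div_mul_cancel₀ _ hj, add_sub_cancel_right]
    rfl
  -- Since `φ (e_i) = -α q`, the height of `r e_j - s e_i` is `(r + s α) q = (b - a) q`. For `q < 0`
  -- the orientation is reversed and `-u` serves.
  let u : Fin (d + 1) → ℤ := r • Pi.single j 1 - s • Pi.single i 1
  have hu : height φ u = (b - a) * q := by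
    rw [map_sub, map_zsmul, map_zsmul, height_apply, height_apply, intVec_single, intVec_single,
      ← hq, zsmul_eq_mul, zsmul_eq_mul, hrs]
    linear_combination -(s : ℝ) * hi
  rcases lt_or_gt_of_ne hj with hneg | hpos
  · have hu' : height φ (-u) = (b - a) * -q := by
      rw [map_neg, hu]
      ring
    refine ⟨-u, θ + φ p - a * q, ?_, fun h hh => ?_, fun h hh => ?_⟩
    · rw [hu']
      exact mul_pos (by linarith) (by linarith)
    · rw [hu'] at hh
      rw [hconv]
      refine hsub ⟨?_, ?_⟩
      · rw [lt_div_iff_of_neg hneg]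
        linarith [hh.1]
      · rw [div_lt_iff_of_neg hneg]
        linarith [hh.2]
    · rw [hu']
      rw [hconv] at hh
      have := hsup hh
      rw [Set.mem_Icc, le_div_iff_of_neg hneg, div_le_iff_of_neg hneg] at this
      constructor <;> linarith [this.1, this.2]
  · refine ⟨u, θ + φ p - b * q, ?_, fun h hh => ?_, fun h hh => ?_⟩
    · rw [hu]
      exact mul_pos (by linarith) hpos
    · rw [hu] at hh
      rw [hconv]
      refine hsub ⟨?_, ?_⟩
      · rw [lt_div_iff₀ hpos]
        linarith [hh.2]
      · rw [div_lt_iff₀ hpos]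
        linarith [hh.1]
    · rw [hu]
      rw [hconv] at hh
      have := hsup hh
      rw [Set.mem_Icc, le_div_iff₀ hpos, div_le_iff₀ hpos] at this
      constructor <;> linarith [this.1, this.2]

theorem IsSpecialFor.exists_irrational {A : Set (EuclideanSpace ℝ (Fin (d + 1)))}
    (hA : IsSpecialFor V A) (hφ : LinearMap.ker φ = V) :
    0 < d ∧ ∃ y z, Irrational (height φ y / height φ z) := by
  obtain ⟨i, j, α, m, γ, a, b, hij, hj, hi, hα, -⟩ := hA
  refine ⟨?_, Pi.single i 1, Pi.single j 1, ?_⟩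
  · by_contra! h
    exact hij (Fin.ext (by omega))
  · rw [← hφ, LinearMap.mem_ker] at hj hi
    rw [map_add, map_smul, smul_eq_mul] at hi
    rw [height_apply, height_apply, intVec_single, intVec_single, eq_neg_of_add_eq_zero_left hi,
      neg_div, mul_div_cancel_right₀ _ hj]
    exact hα.neg

/-- If the direction `w` is rational, the integer vectors parallel to it are the multiples of one of
them. -/
theorem exists_generator {w : EuclideanSpace ℝ (Fin (d + 1))} (hw : φ w ≠ 0)
    {n : Fin (d + 1) → ℤ} (hn : n ≠ 0) (hnw : projAlong φ hφ w hw (intVec (d + 1) n) = 0) :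
    ∃ g, 0 < height φ g ∧ projAlong φ hφ w hw (intVec (d + 1) g) = 0 ∧
      ∀ n, projAlong φ hφ w hw (intVec (d + 1) n) = 0 → ∃ m : ℤ, n = m • g := by
  let Γ : AddSubgroup (Fin (d + 1) → ℤ) :=
    ((projAlong φ hφ w hw).toAddMonoidHom.comp (intVec (d + 1))).ker
  have hΓ : ∀ n, n ∈ Γ ↔ projAlong φ hφ w hw (intVec (d + 1) n) = 0 := fun n => Iff.rfl
  obtain ⟨i, hi⟩ : ∃ i, w i ≠ 0 := by
    by_contra! h
    apply hw
    rw [show w = 0 by ext i; exact h i, map_zero]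
  -- A coordinate in which `w` is nonzero determines a multiple of `w`, so `Γ` embeds in `ℤ` and is
  -- cyclic.
  let f : Γ →+ ℤ := (Pi.evalAddMonoidHom (fun _ : Fin (d + 1) => ℤ) i).comp Γ.subtype
  have hcoord : ∀ n ∈ Γ, n i = 0 → n = 0 := by
    intro n hn h0
    rw [hΓ, projAlong_eq_zero_iff] at hn
    have h1 : intVec (d + 1) n i = _ :=
      congrArg (fun v : EuclideanSpace ℝ (Fin (d + 1)) => v i) hn
    rw [intVec_apply, h0, PiLp.smul_apply, smul_eq_mul, Int.cast_zero, eq_comm, mul_eq_zero,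
      or_iff_left hi] at h1
    rw [h1, zero_smul] at hn
    exact intVec_injective _ (by rw [hn, map_zero])
  have hf : Function.Injective f := by
    rw [injective_iff_map_eq_zero]
    rintro ⟨n, hn⟩ h
    exact Subtype.ext (hcoord n hn h)
  have hcyc : IsAddCyclic Γ := isAddCyclic_of_injective f hf
  obtain ⟨⟨g, hg⟩, hgen⟩ := hcyc.exists_generator
  have hgen' : ∀ n, projAlong φ hφ w hw (intVec (d + 1) n) = 0 → ∃ m : ℤ, n = m • g := by
    intro n hn
    obtain ⟨m, hm⟩ := AddSubgroup.mem_zmultiples_iff.1 (hgen ⟨n, hn⟩)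
    exact ⟨m, (congrArg Subtype.val hm).symm⟩
  have hg0 : height φ g ≠ 0 := by
    intro h
    rw [hΓ, projAlong_eq_zero_iff, ← height_apply, h, zero_mul, zero_smul] at hg
    obtain ⟨m, hm⟩ := hgen' n hnw
    rw [intVec_injective _ (hg.trans (map_zero _).symm), smul_zero] at hm
    exact hn hm
  rcases lt_or_gt_of_ne hg0 with h | h
  · refine ⟨-g, by rw [map_neg]; linarith, by rw [map_neg, map_neg, (hΓ g).1 hg, neg_zero],
      fun n hn => ?_⟩
    obtain ⟨m, hm⟩ := hgen' n hn
    exact ⟨-m, by rw [hm, neg_smul, smul_neg, neg_neg]⟩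
  · exact ⟨g, h, hg, hgen'⟩

/-- A window can be shrunk so that the projection of integer vectors becomes injective, without
changing the set of projected points. -/
theorem exists_injective_window {w : EuclideanSpace ℝ (Fin (d + 1))} (hw : φ w ≠ 0)
    {u : Fin (d + 1) → ℤ} (hu : 0 < height φ u) {T : Set ℝ} {c : ℝ}
    (hT : Set.Ioo c (c + height φ u) ⊆ T) (hT' : T ⊆ Set.Icc c (c + height φ u)) :
    ∃ (u' : Fin (d + 1) → ℤ) (c' : ℝ) (T' : Set ℝ), 0 < height φ u' ∧
      Set.Ioo c' (c' + height φ u') ⊆ T' ∧ T' ⊆ Set.Icc c' (c' + height φ u') ∧ T' ⊆ T ∧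
      (∀ n n', height φ n ∈ T' → height φ n' ∈ T' →
        projAlong φ hφ w hw (intVec (d + 1) n) = projAlong φ hφ w hw (intVec (d + 1) n') →
        n = n') ∧
      ∀ n, height φ n ∈ T → ∃ n', height φ n' ∈ T' ∧
        projAlong φ hφ w hw (intVec (d + 1) n') = projAlong φ hφ w hw (intVec (d + 1) n) := by
  by_cases hinj : ∀ n n', height φ n ∈ T → height φ n' ∈ T →
      projAlong φ hφ w hw (intVec (d + 1) n) = projAlong φ hφ w hw (intVec (d + 1) n') → n = n'
  · exact ⟨u, c, T, hu, hT, hT', subset_rfl, hinj, fun n hn => ⟨n, hn, rfl⟩⟩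
  push Not at hinj
  obtain ⟨n, n', hn, hn', heq, hne⟩ := hinj
  obtain ⟨g, hg, hg0, hgen⟩ := exists_generator φ hφ hw (sub_ne_zero.2 hne)
    (by rw [map_sub, map_sub, heq, sub_self])
  -- Two colliding vectors differ by a nonzero multiple of `g`, so the convex window `T` contains
  -- two heights exactly `height φ g` apart.
  obtain ⟨t, ht, ht'⟩ : ∃ t, t ∈ T ∧ t + height φ g ∈ T := by
    obtain ⟨m, hm⟩ := hgen (n - n') (by rw [map_sub, map_sub, heq, sub_self])
    have hh : height φ n - height φ n' = m * height φ g := by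
      rw [← map_sub, hm, map_zsmul, zsmul_eq_mul]
    have hm0 : m ≠ 0 := by
      rintro rfl
      rw [zero_smul, sub_eq_zero] at hm
      exact hne hm
    rcases lt_or_gt_of_ne hm0 with h | h
    · have h1 : (m : ℝ) ≤ -1 := by exact_mod_cast (by omega : m ≤ -1)
      exact ⟨_, hn, Icc_subset_of_window hT hT' hn hn' ⟨by linarith, by nlinarith⟩⟩
    · have h1 : (1 : ℝ) ≤ m := by exact_mod_cast h
      exact ⟨_, hn', Icc_subset_of_window hT hT' hn' hn ⟨by linarith, by nlinarith⟩⟩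
  -- A half-open window of length `height φ g` meets every coset of `ℤ g` exactly once, and these
  -- cosets are the fibres of the projection along `w` on integer vectors.
  refine ⟨g, t, Set.Ico t (t + height φ g), hg, Set.Ioo_subset_Ico_self, Set.Ico_subset_Icc_self,
    Set.Ico_subset_Icc_self.trans (Icc_subset_of_window hT hT' ht ht'), ?_, ?_⟩
  · intro a b ha hb hab
    obtain ⟨m, hm⟩ := hgen (a - b) (by rw [map_sub, map_sub, hab, sub_self])
    have h1 := existsUnique_map_add_zsmul_mem_Ico (height φ) hg t b
    have h2 : m = 0 := h1.unique (by rwa [← hm, add_sub_cancel]) (by simpa using hb)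
    rw [h2, zero_smul, sub_eq_zero] at hm
    exact hm
  · intro a _
    obtain ⟨m, hm, -⟩ := existsUnique_map_add_zsmul_mem_Ico (height φ) hg t a
    exact ⟨a + m • g, hm, by rw [map_add, map_add, map_zsmul, map_zsmul, hg0, smul_zero, add_zero]⟩

/-- Projections of integer vectors of bounded height are uniformly discrete. -/
theorem exists_le_norm_projAlong {w : EuclideanSpace ℝ (Fin (d + 1))} (hw : φ w ≠ 0) (R : ℝ) :
    ∃ r > 0, ∀ n, |height φ n| ≤ R → projAlong φ hφ w hw (intVec (d + 1) n) ≠ 0 →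
      r ≤ ‖projAlong φ hφ w hw (intVec (d + 1) n)‖ := by
  set D : Set (Fin (d + 1) → ℤ) := {n | |height φ n| ≤ R ∧
    projAlong φ hφ w hw (intVec (d + 1) n) ≠ 0 ∧
    ‖projAlong φ hφ w hw (intVec (d + 1) n)‖ ≤ 1} with hD
  -- An integer vector is the sum of its projection and a multiple of `w` controlled by its height;
  -- bounding both leaves finitely many.
  have hfin : D.Finite := by
    set M := 1 + R * |(φ w)⁻¹| * ‖w‖
    refine (Set.finite_Icc (fun _ => -⌈M⌉) (fun _ => ⌈M⌉)).subset ?_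
    rintro n ⟨h1, -, h2⟩
    have hle : ∀ i, |n i| ≤ ⌈M⌉ := by
      intro i
      have h3 : ‖intVec (d + 1) n i‖ ≤ M := by
        refine (PiLp.norm_apply_le _ i).trans ?_
        have h4 : intVec (d + 1) n = (projAlong φ hφ w hw (intVec (d + 1) n) : _) +
            (height φ n * (φ w)⁻¹) • w := by
          rw [coe_projAlong, ← height_apply, sub_add_cancel]
        rw [h4]
        refine (norm_add_le _ _).trans (add_le_add h2 ?_)
        rw [norm_smul, norm_mul, Real.norm_eq_abs, Real.norm_eq_abs]
        gcongr
      rw [intVec_apply, Real.norm_eq_abs] at h3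
      have h5 := h3.trans (Int.le_ceil M)
      exact_mod_cast h5
    exact ⟨fun i => (abs_le.1 (hle i)).1, fun i => (abs_le.1 (hle i)).2⟩
  rcases D.eq_empty_or_nonempty with hemp | hne
  · refine ⟨1, one_pos, fun n h1 h2 => ?_⟩
    by_contra! h3
    have : n ∈ D := ⟨h1, h2, h3.le⟩
    rw [hemp] at this
    exact this
  · obtain ⟨n₀, hn₀, hmin⟩ := Set.exists_min_image D
      (fun n => ‖projAlong φ hφ w hw (intVec (d + 1) n)‖) hfin hne
    refine ⟨‖projAlong φ hφ w hw (intVec (d + 1) n₀)‖, norm_pos_iff.2 hn₀.2.1, fun n h1 h2 => ?_⟩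
    by_cases h3 : ‖projAlong φ hφ w hw (intVec (d + 1) n)‖ ≤ 1
    · exact hmin n ⟨h1, h2, h3⟩
    · exact hn₀.2.2.trans (not_le.1 h3).le

end Main

/-! ### Separated nets -/

section Nets

variable {E : Type*} [NormedAddCommGroup E] [NormedSpace ℝ E] {ι : Type*} [Finite ι]

theorem isSeparatedNet_span (b : Module.Basis ι ℝ E) :
    IsSeparatedNet (Submodule.span ℤ (Set.range b) : Set E) := by
  have := Fintype.ofFinite ι
  constructor
  · obtain ⟨r, hr, h⟩ := Metric.nhds_basis_ball.exists_inter_eq_singleton_of_mem_discrete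
      (s := (Submodule.span ℤ (Set.range b) : Set E)) (x := 0)
      ⟨inferInstanceAs (DiscreteTopology (Submodule.span ℤ (Set.range b)))⟩
      (Submodule.zero_mem _)
    refine ⟨r, hr, fun y hy y' hy' hne => ?_⟩
    by_contra! hlt
    have h1 : y - y' ∈ Metric.ball 0 r ∩ (Submodule.span ℤ (Set.range b) : Set E) :=
      ⟨by rwa [mem_ball_zero_iff, ← dist_eq_norm], Submodule.sub_mem _ hy hy'⟩
    rw [h] at h1
    exact hne (sub_eq_zero.1 h1)
  · refine ⟨∑ i, ‖b i‖ + 1, by positivity, fun x => ⟨_, (ZSpan.floor b x).2, ?_⟩⟩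
    rw [dist_comm, dist_eq_norm]
    have := ZSpan.norm_fract_le b x
    rw [ZSpan.fract_apply] at this
    linarith

/-- Relative density passes from the lattice to `Y` through the matching. Uniform discreteness does
not, so it is a separate hypothesis. -/
theorem isBDToLattice_of_familyBD {Y : Set E} (b : Module.Basis ι ℝ E)
    (hY : ∃ r : ℝ, 0 < r ∧ ∀ y ∈ Y, ∀ y' ∈ Y, y ≠ y' → r ≤ dist y y')
    (h : FamilyBD (Subtype.val : Y → E)
      (Subtype.val : (Submodule.span ℤ (Set.range b)) → E)) : IsBDToLattice Y := by
  obtain ⟨e, C, he⟩ := h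
  have hL := isSeparatedNet_span b
  refine ⟨Submodule.span ℤ (Set.range b), inferInstance, inferInstance,
    ⟨⟨hY, ?_⟩, hL, e, C, fun y => ?_⟩⟩
  · obtain ⟨R, hR, h⟩ := hL.2
    refine ⟨R + |C|, by positivity, fun x => ?_⟩
    obtain ⟨y, hy, hyx⟩ := h x
    refine ⟨_, (e.symm ⟨y, hy⟩).2, ?_⟩
    have h1 := he (e.symm ⟨y, hy⟩)
    rw [Equiv.apply_symm_apply, ← dist_eq_norm] at h1
    linarith [dist_triangle ((e.symm ⟨y, hy⟩ : Y) : E) y x, le_abs_self C]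
  · rw [dist_comm, dist_eq_norm]
    exact he y

end Nets

/-! ### The cut-and-project set in terms of integer vectors -/

theorem torusProj_eq_iff {k : ℕ} {a b : EuclideanSpace ℝ (Fin k)} :
    torusProj a = torusProj b ↔ ∃ n, a = b + intVec k n := by
  constructor
  · intro h
    have h1 : ∀ i, ∃ n : ℤ, a i = b i + n := fun i =>
      unitAddCircle_coe_eq_iff.1 (congrFun h i)
    choose n hn using h1
    exact ⟨n, by ext i; simpa using hn i⟩
  · rintro ⟨n, rfl⟩
    ext i
    exact unitAddCircle_coe_eq_iff.2 ⟨n i, by simp⟩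

/-- Membership means `v + x = p + t • w + n` with `n` integral and `p + t • w ∈ A`. Applying `φ`
gives `t = φ (x - p) - φ n`, and projecting along `w` gives the formula for `v`. -/
theorem mem_cutAndProject_iff {d : ℕ} {V : Submodule ℝ (EuclideanSpace ℝ (Fin (d + 1)))}
    (φ : EuclideanSpace ℝ (Fin (d + 1)) →ₗ[ℝ] ℝ) (hφ : LinearMap.ker φ = V)
    {w : EuclideanSpace ℝ (Fin (d + 1))} (hw : φ w ≠ 0) (hw1 : φ w = 1)
    (p x : EuclideanSpace ℝ (Fin (d + 1))) {A : Set (EuclideanSpace ℝ (Fin (d + 1)))}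
    (hline : A ⊆ Set.range fun t : ℝ => p + t • w) (v : V) :
    v ∈ cutAndProject V (torusProj '' A) x ↔
      ∃ n, height φ n ∈ {h | p + (φ (x - p) - h) • w ∈ A} ∧
        v = projAlong φ hφ w hw (p - x) + projAlong φ hφ w hw (intVec (d + 1) n) := by
  have hv : φ v = 0 := by
    rw [← LinearMap.mem_ker, hφ]
    exact v.2
  constructor
  · rintro ⟨s, hs, hsv⟩
    obtain ⟨n, hn⟩ := torusProj_eq_iff.1 hsv.symm
    obtain ⟨t, rfl⟩ := hline hs
    have h1 : height φ n = φ (x - p) - t := by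
      have := congrArg φ hn
      simp only [map_add, hv, map_smul, hw1, smul_eq_mul] at this
      rw [height_apply, map_sub]
      linarith
    refine ⟨n, ?_, ?_⟩
    · rw [Set.mem_ofPred_eq, h1, sub_sub_cancel]
      exact hs
    · refine Subtype.ext ?_
      rw [Submodule.coe_add, coe_projAlong, coe_projAlong, ← height_apply, h1, hw1, inv_one,
        mul_one, mul_one, map_sub, map_sub, eq_sub_of_add_eq hn]
      module
  · rintro ⟨n, hn, rfl⟩
    refine ⟨_, hn, torusProj_eq_iff.2 ⟨-n, ?_⟩⟩
    rw [Submodule.coe_add, coe_projAlong, coe_projAlong, ← height_apply, hw1, inv_one, mul_one,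
      mul_one, map_sub, map_sub, map_neg]
    module

theorem familyBD_lattice_span {E : Type*} [NormedAddCommGroup E] [NormedSpace ℝ E] {d : ℕ}
    (κ : E ≃ₗ[ℝ] (Fin d → ℝ)) (o : Fin d) {c : ℝ} (hc : 0 < c) :
    ∃ b : Module.Basis (Fin d) ℝ E, FamilyBD (fun n => κ.symm (latticePoint (stretch o c) n))
      (Subtype.val : (Submodule.span ℤ (Set.range b)) → E) := by
  let D : Fin d → ℝ := Function.update 1 o c
  have hD : ∀ i, IsUnit (D i) := fun i => by
    simp only [D, Function.update_apply, isUnit_iff_ne_zero]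
    split_ifs <;> simp [hc.ne']
  let b := ((Pi.basisFun ℝ (Fin d)).isUnitSMul hD).map κ.symm
  refine ⟨b, .of_equiv (b.restrictScalars ℤ).equivFun.symm.toEquiv fun n => ?_⟩
  change _ = (((b.restrictScalars ℤ).equivFun.symm n : Submodule.span ℤ (Set.range b)) : E)
  rw [Module.Basis.equivFun_symm_apply, Submodule.coe_sum]
  simp only [Submodule.coe_smul, Module.Basis.restrictScalars_apply, b, Module.Basis.map_apply,
    Module.Basis.isUnitSMul_apply, ← map_zsmul, ← map_sum]
  congr 1
  ext i
  simp [latticePoint, stretch, Matrix.mulVec_diagonal, D, Finset.sum_apply, Pi.single_apply,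
    mul_comm]

end CutProject

end

theorem corollary1p2 {k : ℕ} (V : Submodule ℝ (EuclideanSpace ℝ (Fin k)))
    (hV : Module.finrank ℝ V + 1 = k)
    (x p w : EuclideanSpace ℝ (Fin k)) (hw : w ∉ V)
    {N : ℕ} (hN : 0 < N) (A : Fin N → Set (EuclideanSpace ℝ (Fin k)))
    (hline : ∀ l, A l ⊆ Set.range fun t : ℝ => p + t • w)
    (hspecial : ∀ l, CutProject.IsSpecialFor V (A l))
    (hdisj : Pairwise fun l l' =>
      Disjoint (CutProject.torusProj '' A l) (CutProject.torusProj '' A l'))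
    (S : Set (UnitAddTorus (Fin k))) (hS : S = ⋃ l, CutProject.torusProj '' A l) :
    CutProject.IsBDToLattice (CutProject.cutAndProject V S x) := by
  open CutProject in
  obtain ⟨d, rfl⟩ : ∃ d, k = d + 1 := ⟨_, hV.symm⟩
  have hVd : Module.finrank ℝ V = d := by omega
  obtain ⟨φ, hφ, hw1⟩ := exists_functional hVd hw
  have hw0 : φ w ≠ 0 := by rw [hw1]; exact one_ne_zero
  obtain ⟨hd, y, z, hyz⟩ := (hspecial ⟨0, hN⟩).exists_irrational φ hφ
  choose u c hu hT hT' using fun l =>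
    (hspecial l).exists_window φ hφ hw1 (hline l) (φ (x - p))
  choose u' c' T' hu' hIoo hIcc hsub hinj hsurj using fun l =>
    exists_injective_window φ hφ hw0 (hu l) (hT l) (hT' l)
  have hirr : ∀ l, ∃ z', Irrational (height φ z' / height φ (u' l)) := fun l =>
    (exists_irrational_div (hu' l).ne' hyz).elim (fun h => ⟨_, h⟩) fun h => ⟨_, h⟩
  let κ : V ≃ₗ[ℝ] (Fin d → ℝ) := LinearEquiv.ofFinrankEq _ _ (by simp [hVd])
  let o : Fin d := ⟨0, hd⟩
  let P := projAlong φ hφ w hw0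
  have hmem := fun l => mem_cutAndProject_iff φ hφ hw0 hw1 p x (hline l)
  have hY : ∀ v, v ∈ cutAndProject V S x ↔
      ∃ l, v ∈ cutAndProject V (torusProj '' A l) x := by
    intro v
    simp [cutAndProject, hS]
  obtain ⟨c₀, hc₀, hfam⟩ := familyBD_sigma_stretch o hN
    (fun l => levelFamily (height φ) (projInt φ hφ w hw0 κ) (T' l))
    (fun l => exists_familyBD_window φ hφ hw0 κ.toLinearMap κ.injective o (hu' l)
      (hirr l).choose_spec (hIoo l) (hIcc l))
  obtain ⟨b, hb⟩ := familyBD_lattice_span κ o hc₀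
  have hfam' : FamilyBD (fun n : Σ l, {n // height φ n ∈ T' l} => P (intVec (d + 1) n.2))
      (fun n => κ.symm (latticePoint (stretch o c₀) n)) := by
    have := hfam.map κ.symm.toLinearMap.toContinuousLinearMap
    simpa [levelFamily, projInt_apply] using this
  refine isBDToLattice_of_familyBD b ?_ (.trans (.symm (.trans (.of_bounded ‖P (p - x)‖ ?_)
    (.of_equiv (Equiv.ofBijective (fun n : Σ l, {n // height φ n ∈ T' l} =>
      ⟨P (p - x) + P (intVec (d + 1) n.2),
        (hY _).2 ⟨n.1, (hmem _ _).2 ⟨n.2, hsub _ n.2.2, rfl⟩⟩⟩) ⟨?_, ?_⟩) fun n => rfl)))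
    (hfam'.trans hb))
  -- Uniform discreteness: one bound `R` serves all windows, so differences of points, even from
  -- different windows, come from integer vectors of height at most `2R`.
  · obtain ⟨R, hR⟩ : ∃ R, ∀ l n, height φ n ∈ {h | p + (φ (x - p) - h) • w ∈ A l} →
        |height φ n| ≤ R := by
      refine ⟨∑ l, (|c l| + height φ (u l)), fun l n hn => ?_⟩
      have h1 : |height φ n| ≤ |c l| + height φ (u l) := by
        have := hT' l hn
        rw [abs_le]
        constructor <;> linarith [this.1, this.2, neg_abs_le (c l), le_abs_self (c l), hu l]
      exact h1.trans (Finset.single_le_sum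
        (f := fun l => |c l| + height φ (u l))
        (fun l _ => add_nonneg (abs_nonneg _) (hu l).le) (Finset.mem_univ l))
    obtain ⟨r, hr, h⟩ := exists_le_norm_projAlong φ hφ hw0 (R + R)
    refine ⟨r, hr, fun v hv v' hv' hne => ?_⟩
    obtain ⟨l, hv⟩ := (hY v).1 hv
    obtain ⟨l', hv'⟩ := (hY v').1 hv'
    obtain ⟨n, hn, rfl⟩ := (hmem _ _).1 hv
    obtain ⟨n', hn', rfl⟩ := (hmem _ _).1 hv'
    have h1 := h (n - n') ?_ ?_
    · rw [map_sub, map_sub] at h1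
      rwa [dist_eq_norm, add_sub_add_left_eq_sub]
    · rw [map_sub]
      exact (abs_sub _ _).trans (add_le_add (hR l n hn) (hR l' n' hn'))
    · rw [map_sub, map_sub, sub_ne_zero]
      exact fun h => hne (by rw [h])
  · have h : ∀ a b : V, ‖b - (a + b)‖ ≤ ‖a‖ := fun a b => by rw [sub_add_cancel_right, norm_neg]
    exact fun n => h _ _
  -- Within one window the shrinking gives injectivity; between different windows the disjointness
  -- of the images in the torus does.
  · rintro ⟨l, n, hn⟩ ⟨l', n', hn'⟩ h
    have hv : P (p - x) + P (intVec (d + 1) n) = P (p - x) + P (intVec (d + 1) n') :=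
      congrArg Subtype.val h
    by_cases hl : l = l'
    · subst hl
      have := hinj l n n' hn hn' (add_left_cancel hv)
      subst this
      rfl
    · have h1 := (hmem l _).2 ⟨n, hsub _ hn, rfl⟩
      have h2 := (hmem l' _).2 ⟨n', hsub _ hn', hv⟩
      exact absurd h2 (Set.disjoint_left.1 (hdisj hl) h1)
  · rintro ⟨v, hv⟩
    obtain ⟨l, hv⟩ := (hY v).1 hv
    obtain ⟨n, hn, rfl⟩ := (hmem _ _).1 hv
    obtain ⟨n', hn', heq⟩ := hsurj l n hn
    exact ⟨⟨l, n', hn'⟩, Subtype.ext (congrArg (P (p - x) + ·) heq)⟩
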